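/- Let $M$ be a connected, oriented, smooth (Hausdorff, second countable) manifold of dimension $n\ge 1$ without boundary, with tangent bundle $\pi:TM\to M$. For $h\in C^\infty(M)$ let $\dot h(u)=u\langle h\rangle$ be its scalar lift to $TM$, and let $\mathcal R=\dot x^\mu\,\partial/\partial\dot x^\mu$ be the radial vector field. Let $U\subset TM$ be a conic sub-bundle, that is, an open set of non-zero vectors with $\pi(U)=M$ such that $\lambda u\in U$ for all $u\in U$ and $\lambda\neq0$. A Vlasov field on $U$ is a smooth vector field $W$ on $U$ with $\pi_*(W|_u)=u$ and $W\langle\dot h\rangle|_{\lambda u}=\lambda^2\,W\langle\dot h\rangle|_u$ for all $u\in U$, $\lambda>0$ and $h\in C^\infty(M)$. A Vlasov bivector on $U$ is a bivector field of the form $\Psi=\mathcal R\wedge W$ with $W$ a Vlasov field. Let $\Psi$ be a Vlasov bivector on $U$ and let $\theta$ be a smooth $(2n-2)$-form on $U$ (a particle density form) satisfying the transport equations: $d\theta=0$, and $i_X\theta=i_Y\theta=0$ for all smooth vector fields $X,Y$ on $U$ with $\Psi=X\wedge Y$. Let $\chi$ be a support form on $U$: a smooth $1$-form whose pull-back to every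 ray $\{\lambda u:\lambda>0\}$, $u\in U$, has compact support in the ray and satisfies $\int_0^\infty\chi|_{\lambda u}\big(\tfrac{d}{d\lambda}(\lambda u)\big)\,d\lambda=1$. Assume that $\chi\wedge\theta$ has vertical compact support: for each $p\in M$, its restriction to $U_p=U\cap T_pM$ has compact support in $U_p$. Let $\mathcal J=\pi_\varsigma(\chi\wedge\theta)$ be its integral along the fibres of $U$, an $(n-1)$-form on $M$; in oriented coordinates, $\pi_\varsigma$ sends $f\,dx^I\wedge d\dot x^1\wedge\dots\wedge d\dot x^n$ to $\big(\int_{U_p} f\,d\dot x^1\cdots d\dot x^n\big)dx^I$ and forms of lower degree in the $d\dot x^\mu$ to $0$. Then the current $\mathcal J$ satisfies the continuity equation (charge conservation) $$d\mathcal J=0$$ whenever $\mathcal J$ is a smooth form on $M$; and $\mathcal J$ is always smooth if the support of $\chi\wedge\theta$ in $U$ meets $\pi^{-1}(K)$ in a compact set for every compact $K\subset M$. -/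

import Mathlib

open Set Filter Topology MeasureTheory Bundle
open scoped Manifold ContDiff

noncomputable section

/-! ### Differential forms and vector fields on a manifold -/

section Forms

variable {E H N : Type*} [NormedAddCommGroup E] [NormedSpace ℝ E] [TopologicalSpace H]
  (I : ModelWithCorners ℝ E H) [TopologicalSpace N] [ChartedSpace H N]

/-- A (not necessarily smooth) differential `k`-form on the manifold `N`. A form on an open subset
`U` of `N` is treated as a form on `N` of which only the values at the points of `U` are used. -/
abbrev DiffForm (N : Type*) [TopologicalSpace N] [ChartedSpace H N] (k : ℕ) : Type _ :=
  ∀ x : N, TangentSpace I x [⋀^Fin k]→L[ℝ] ℝ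

variable {I}

/-- The expression of the form `α` in the chart around `x₀`: the pull-back of `α` by the inverse of
the chart, a form on the model vector space. -/
def DiffForm.inChart {k : ℕ} (α : DiffForm I N k) (x₀ : N) (y : E) : E [⋀^Fin k]→L[ℝ] ℝ :=
  (α ((extChartAt I x₀).symm y)).compContinuousLinearMap
    (mfderiv 𝓘(ℝ, E) I (extChartAt I x₀).symm y)

/-- The form `α` is smooth on the open set `s`. -/
def DiffForm.SmoothOn {k : ℕ} (α : DiffForm I N k) (s : Set N) : Prop :=
  ∀ x ∈ s, ContDiffAt ℝ ∞ (α.inChart x) (extChartAt I x x)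

/-- The exterior derivative of a form on a manifold without boundary, computed in the chart around
each point. -/
def DiffForm.d {k : ℕ} (α : DiffForm I N k) : DiffForm I N (k + 1) := fun x =>
  (extDeriv (α.inChart x) (extChartAt I x x)).compContinuousLinearMap
    (mfderiv I 𝓘(ℝ, E) (extChartAt I x) x)

/-- The wedge product `χ ∧ θ` of a `1`-form and a `k`-form:
`(χ ∧ θ)(v₀, …, v_k) = ∑ i, (-1) ^ i * χ(v_i) * θ(v₀, …, v_{i-1}, v_{i+1}, …, v_k)`. -/
def DiffForm.wedgeOne {k : ℕ} (χ : DiffForm I N 1) (θ : DiffForm I N k) : DiffForm I N (k + 1) :=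
  fun x => ContinuousAlternatingMap.alternatizeUncurryFin (E := E) (F := ℝ)
    (((ContinuousAlternatingMap.ofSubsingleton ℝ E ℝ (0 : Fin 1)).symm (χ x)).smulRight (θ x))

/-- The interior contraction `i_X α` vanishes on `s`: at every point of `s`, the form `α` vanishes
as soon as one of its arguments is `X`. (For a `0`-form this always holds.) -/
def DiffForm.ContractionVanishesOn {k : ℕ} (X : ∀ x : N, TangentSpace I x) (α : DiffForm I N k)
    (s : Set N) : Prop :=
  ∀ x ∈ s, ∀ v : Fin k → TangentSpace I x, (∃ i, v i = X x) → α x v = 0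

variable (I) in
/-- The vector field `X` is smooth on the open set `s`. -/
def SmoothVectorFieldOn [IsManifold I 1 N] (X : ∀ x : N, TangentSpace I x) (s : Set N) : Prop :=
  ContMDiffOn I I.tangent ∞ (fun x => (⟨x, X x⟩ : TangentBundle I N)) s

/-- The derivative `X⟨h⟩` of a scalar field `h` along a vector field `X`. -/
def vectorDeriv (X : ∀ x : N, TangentSpace I x) (h : N → ℝ) (x : N) : ℝ :=
  mfderiv I 𝓘(ℝ, ℝ) h x (X x)

variable (I) in
/-- A bivector field on `N`. -/
abbrev BivectorField (N : Type*) [TopologicalSpace N] [ChartedSpace H N] : Type _ :=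
  ∀ x : N, ⋀[ℝ]^2 (TangentSpace I x)

/-- The simple bivector field `X ∧ Y`. -/
def simpleBivector (X Y : ∀ x : N, TangentSpace I x) : BivectorField I N :=
  fun x => exteriorPower.ιMulti ℝ 2 ![X x, Y x]

/-- The null condition `Null(Φ, α)` on the open set `s`: for all smooth vector fields `X`, `Y` on `s`
with `Φ = X ∧ Y` on `s`, both `i_X α = 0` and `i_Y α = 0` on `s`. -/
def NullConditionOn [IsManifold I 1 N] {k : ℕ} (Φ : BivectorField I N) (α : DiffForm I N k)
    (s : Set N) : Prop :=
  ∀ X Y : ∀ x : N, TangentSpace I x, SmoothVectorFieldOn I X s → SmoothVectorFieldOn I Y s →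
    (∀ x ∈ s, Φ x = simpleBivector X Y x) →
      α.ContractionVanishesOn X s ∧ α.ContractionVanishesOn Y s

end Forms

/-! ### Conic sub-bundles of the tangent bundle, Vlasov fields and Vlasov bivectors -/

section Vlasov

variable {n : ℕ} {M : Type*} [TopologicalSpace M] [ChartedSpace (EuclideanSpace ℝ (Fin n)) M]
  [IsManifold (𝓡 n) ∞ M]

/-- A conic sub-bundle: an open subset of the slit tangent bundle, with non-empty fibres, invariant
under multiplication by non-zero scalars. -/
structure IsConicSubbundle (U : Set (TangentBundle (𝓡 n) M)) : Prop where
  isOpen : IsOpen U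
  ne_zero : ∀ u ∈ U, u.2 ≠ 0
  proj_image : (fun u : TangentBundle (𝓡 n) M => u.proj) '' U = univ
  smul_mem : ∀ u ∈ U, ∀ c : ℝ, c ≠ 0 → (⟨u.proj, c • u.2⟩ : TangentBundle (𝓡 n) M) ∈ U

/-- The inclusion `y ↦ (p, y)` of the fibre `T_p M` in `TM`. -/
def fibreIncl (p : M) (y : EuclideanSpace ℝ (Fin n)) : TangentBundle (𝓡 n) M := ⟨p, y⟩

/-- The vertical lift of `e ∈ T_p M` to `T_u TM`, where `p = π u`: the velocity of the curve
`t ↦ u + t e` in the fibre. -/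
def verticalLift (u : TangentBundle (𝓡 n) M) (e : EuclideanSpace ℝ (Fin n)) :
    TangentSpace (𝓡 n).tangent u :=
  mfderiv 𝓘(ℝ, EuclideanSpace ℝ (Fin n)) (𝓡 n).tangent (fibreIncl (M := M) u.proj) u.2 e

/-- The radial vector field `ẋ^μ ∂/∂ẋ^μ`. -/
def radialField (u : TangentBundle (𝓡 n) M) : TangentSpace (𝓡 n).tangent u :=
  verticalLift u u.2

/-- The scalar lift `ḣ(u) = u⟨h⟩` of a scalar field `h`. -/
def scalarLift (h : M → ℝ) (u : TangentBundle (𝓡 n) M) : ℝ :=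
  mfderiv (𝓡 n) 𝓘(ℝ, ℝ) h u.proj u.2

/-- A Vlasov field on `U`: a smooth vector field on `U` which is horizontal, `π_* (W u) = u`, and
radially quadratic. -/
structure IsVlasovField (U : Set (TangentBundle (𝓡 n) M))
    (W : ∀ u : TangentBundle (𝓡 n) M, TangentSpace (𝓡 n).tangent u) : Prop where
  smooth : SmoothVectorFieldOn (𝓡 n).tangent W U
  horizontal : ∀ u ∈ U,
    mfderiv (𝓡 n).tangent (𝓡 n) (fun w : TangentBundle (𝓡 n) M => w.proj) u (W u) = u.2
  radially_quadratic : ∀ h : M → ℝ, ContMDiff (𝓡 n) 𝓘(ℝ, ℝ) ∞ h → ∀ u ∈ U, ∀ c : ℝ, 0 < c →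
    vectorDeriv W (scalarLift h) ⟨u.proj, c • u.2⟩ = c ^ 2 * vectorDeriv W (scalarLift h) u

/-- A Vlasov bivector on `U`: a bivector field of the form `ℛ ∧ W` with `ℛ` the radial field and `W`
a Vlasov field. -/
def IsVlasovBivector (U : Set (TangentBundle (𝓡 n) M))
    (Ψ : BivectorField (𝓡 n).tangent (TangentBundle (𝓡 n) M)) : Prop :=
  ∃ W : ∀ u : TangentBundle (𝓡 n) M, TangentSpace (𝓡 n).tangent u,
    IsVlasovField U W ∧ ∀ u ∈ U, Ψ u = simpleBivector radialField W u

/-- A particle density form on `U`: a smooth `(2n-2)`-form satisfying the transport equations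
`Null(Ψ, θ)` and `dθ = 0`. -/
structure TransportEquations (U : Set (TangentBundle (𝓡 n) M))
    (Ψ : BivectorField (𝓡 n).tangent (TangentBundle (𝓡 n) M))
    (θ : DiffForm (𝓡 n).tangent (TangentBundle (𝓡 n) M) (2 * n - 2)) : Prop where
  smooth : θ.SmoothOn U
  null : NullConditionOn Ψ θ U
  closed : ∀ u ∈ U, θ.d u = 0

/-- The coefficient of the pull-back of the `1`-form `χ` to the ray `{c u : c > 0}`: this pull-back
is `rayCoefficient χ u c dc`. -/
def rayCoefficient (χ : DiffForm (𝓡 n).tangent (TangentBundle (𝓡 n) M) 1)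
    (u : TangentBundle (𝓡 n) M) (c : ℝ) : ℝ :=
  χ (fibreIncl u.proj (c • u.2)) (fun _ => verticalLift (fibreIncl u.proj (c • u.2)) u.2)

/-- A support form on `U`: a smooth `1`-form on `U` whose pull-back to each ray `{c u : c > 0}` in
`U` has compact support in the ray and integral `1`. -/
structure IsSupportForm (U : Set (TangentBundle (𝓡 n) M))
    (χ : DiffForm (𝓡 n).tangent (TangentBundle (𝓡 n) M) 1) : Prop where
  smooth : χ.SmoothOn U
  compact_support : ∀ u ∈ U, ∃ K ⊆ Ioi (0 : ℝ), IsCompact K ∧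
    ∀ c : ℝ, 0 < c → c ∉ K → rayCoefficient χ u c = 0
  integral_eq_one : ∀ u ∈ U, ∫ c in Ioi (0 : ℝ), rayCoefficient χ u c = 1

end Vlasov

/-! ### Integration along the fibre -/

section Fibre

variable {n : ℕ} {M : Type*} [TopologicalSpace M] [ChartedSpace (EuclideanSpace ℝ (Fin n)) M]
  [IsManifold (𝓡 n) ∞ M]

variable (n M) in
/-- An orientation of the manifold `M`, that is, of the vector bundle `TM`: an orientation of each
tangent space, locally constant in the local trivialisations of `TM`. -/
structure ManifoldOrientation where
  orient : ∀ p : M, Orientation ℝ (TangentSpace (𝓡 n) p) (Fin n)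
  locally_constant : ∀ p : M,
    ∃ w : Orientation ℝ (EuclideanSpace ℝ (Fin n)) (Fin n), ∀ᶠ q in 𝓝 p,
      ∀ hq : q ∈ (trivializationAt (EuclideanSpace ℝ (Fin n)) (TangentSpace (𝓡 n)) p).baseSet,
        Orientation.map (Fin n)
          ((trivializationAt (EuclideanSpace ℝ (Fin n)) (TangentSpace (𝓡 n)) p).linearEquivAt
            ℝ q hq) (orient q) = w

open Classical in
/-- The sign of the standard basis of the model space `EuclideanSpace ℝ (Fin n)` of `T_p M` with
respect to the given orientation. -/
def ManifoldOrientation.sign (o : ManifoldOrientation n M) (p : M) : ℝ :=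
  if o.orient p = (EuclideanSpace.basisFun (Fin n) ℝ).toBasis.orientation then 1 else -1

/-- A linear lift of `T_p M` to `T_u TM`, where `p = π u`: the differential at `p` of a smooth local
section of `TM` through `u`. -/
def sectionLift (u : TangentBundle (𝓡 n) M) :
    TangentSpace (𝓡 n) u.proj →L[ℝ] TangentSpace (𝓡 n).tangent u :=
  mfderiv (𝓡 n) (𝓡 n).tangent
    (fun q => (⟨q, FiberBundle.extend (EuclideanSpace ℝ (Fin n)) u.2 q⟩ : TangentBundle (𝓡 n) M))
    u.proj

/-- `sectionLift` is a lift. -/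
theorem mfderiv_proj_sectionLift (u : TangentBundle (𝓡 n) M) (v : TangentSpace (𝓡 n) u.proj) :
    mfderiv (𝓡 n).tangent (𝓡 n) (fun w : TangentBundle (𝓡 n) M => w.proj) u (sectionLift u v) = v := by
  have h1 : MDifferentiableAt (𝓡 n).tangent (𝓡 n) (fun w : TangentBundle (𝓡 n) M => w.proj) u :=
    (contMDiffAt_proj (n := 1) (TangentSpace (𝓡 n))).mdifferentiableAt one_ne_zero
  have h2 := FiberBundle.mdifferentiableAt_extend (𝓡 n) (EuclideanSpace ℝ (Fin n)) u.2
  have h3 : (⟨u.proj, FiberBundle.extend (EuclideanSpace ℝ (Fin n)) u.2 u.proj⟩ :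
      TangentBundle (𝓡 n) M) = u := by simp
  have h4 := (h3.symm ▸ h1.hasMFDerivAt :
    HasMFDerivAt (𝓡 n).tangent (𝓡 n) (fun w : TangentBundle (𝓡 n) M => w.proj)
      (⟨u.proj, FiberBundle.extend (EuclideanSpace ℝ (Fin n)) u.2 u.proj⟩ : TangentBundle (𝓡 n) M)
      (mfderiv (𝓡 n).tangent (𝓡 n) (fun w : TangentBundle (𝓡 n) M => w.proj) u))
  have h5 := h4.comp u.proj h2.hasMFDerivAt
  have h6 := hasMFDerivAt_unique h5 (hasMFDerivAt_id u.proj)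
  exact congrArg (fun f => f v) h6

theorem append_update_cast {E V : Type*} {q k m : ℕ} (hq : q = k + m) (L : E → V) (e : Fin m → V)
    [DecidableEq (Fin k)] [DecidableEq (Fin q)] (v : Fin k → E) (i : Fin k) (z : E) :
    (fun l => Fin.append (fun j => L (Function.update v i z j)) e (Fin.cast hq l)) =
      Function.update (fun l => Fin.append (fun j => L (v j)) e (Fin.cast hq l))
        (Fin.cast hq.symm (Fin.castAdd m i)) (L z) := by
  subst hq
  funext l
  refine Fin.addCases (fun j => ?_) (fun j => ?_) l
  · by_cases hj : j = i <;> simp [Function.update_apply, hj]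
  · have h : Fin.natAdd k j ≠ Fin.castAdd m i := by
      intro h
      have := congrArg Fin.val h
      simp only [Fin.val_natAdd, Fin.val_castAdd] at this
      omega
    simp [Function.update_apply, h]

/-- For an alternating map `A` of degree `q = k + m`, a linear map `L` and vectors `e₁, …, e_m`, the
alternating map `(v₁, …, v_k) ↦ A(L v₁, …, L v_k, e₁, …, e_m)`. -/
def contractLast {E V : Type*} [NormedAddCommGroup E] [NormedSpace ℝ E] [AddCommGroup V]
    [TopologicalSpace V] [Module ℝ V] {q k m : ℕ} (hq : q = k + m)
    (A : V [⋀^Fin q]→L[ℝ] ℝ) (L : E →L[ℝ] V) (e : Fin m → V) : E [⋀^Fin k]→L[ℝ] ℝ where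
  toFun v := A (fun i => Fin.append (fun j => L (v j)) e (Fin.cast hq i))
  map_update_add' := by
    intro _ v i x y
    simp only [append_update_cast hq L e v i, map_add, ContinuousAlternatingMap.map_update_add]
  map_update_smul' := by
    intro _ v i c x
    simp only [append_update_cast hq L e v i, map_smul, ContinuousAlternatingMap.map_update_smul]
  map_eq_zero_of_eq' := by
    intro v i j hv hij
    exact A.map_eq_zero_of_eq _ (i := Fin.cast hq.symm (Fin.castAdd m i))
      (j := Fin.cast hq.symm (Fin.castAdd m j)) (by simp [hv])
      (by simpa [Fin.ext_iff] using hij)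
  cont := by
    refine A.cont.comp (continuous_pi fun i => ?_)
    subst hq
    refine Fin.addCases (fun j => ?_) (fun j => ?_) i
    · simpa using L.continuous.comp' (continuous_apply j)
    · simpa using continuous_const

/-- The restriction of `α` to each fibre `U ∩ T_p M` of `U` has compact support in that fibre. -/
def HasVerticalCompactSupport (U : Set (TangentBundle (𝓡 n) M)) {q : ℕ}
    (α : DiffForm (𝓡 n).tangent (TangentBundle (𝓡 n) M) q) : Prop :=
  ∀ p : M, ∃ K : Set (EuclideanSpace ℝ (Fin n)), IsCompact K ∧ (∀ y ∈ K, fibreIncl p y ∈ U) ∧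
    ∀ y, fibreIncl p y ∈ U → y ∉ K → α (fibreIncl p y) = 0

/-- The support of `α` in `U` has compact intersection with `π ⁻¹ (K)` for each compact `K ⊆ M`. -/
def HasProperVerticalSupport (U : Set (TangentBundle (𝓡 n) M)) {q : ℕ}
    (α : DiffForm (𝓡 n).tangent (TangentBundle (𝓡 n) M) q) : Prop :=
  ∀ K : Set M, IsCompact K → ∃ C ⊆ U, IsCompact C ∧ ∀ u ∈ U, u.proj ∈ K → u ∉ C → α u = 0

/-- The integral along the fibre `π_ς α` of a form `α` of degree `q = k + n` on `U`, a `k`-form on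
`M`: at `p`, the arguments `v₁, …, v_k ∈ T_p M` are lifted to `U`, the last `n` slots of `α` are filled
with the vertical lifts of the standard basis of the model space of `T_p M`, and the result is
integrated over the fibre `U ∩ T_p M`, oriented by the orientation of `T_p M`. The value does not
depend on the lifts, since `n + 1` vertical vectors are linearly dependent. In coordinates,
`π_ς (f dx^I ∧ dẋ¹ ∧ ⋯ ∧ dẋⁿ) = (∫ f dẋ¹ ⋯ dẋⁿ) dx^I`, so that
`∫_U π^* β ∧ α = ∫_M β ∧ π_ς α` for every form `β` of compact support. -/
def fibreIntegral (o : ManifoldOrientation n M) (U : Set (TangentBundle (𝓡 n) M)) {q k : ℕ}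
    (hq : q = k + n) (α : DiffForm (𝓡 n).tangent (TangentBundle (𝓡 n) M) q) :
    DiffForm (𝓡 n) M k := fun p =>
  o.sign p • ∫ y in {y : EuclideanSpace ℝ (Fin n) | fibreIncl p y ∈ U},
    contractLast hq (E := EuclideanSpace ℝ (Fin n)) (α (fibreIncl p y))
      (sectionLift (fibreIncl p y))
      (fun i => verticalLift (fibreIncl p y) (EuclideanSpace.basisFun (Fin n) ℝ i))

/-- The current `𝒥 = π_ς (χ ∧ θ)`, an `(n-1)`-form on `M`. -/
def current (hn : 1 ≤ n) (o : ManifoldOrientation n M) (U : Set (TangentBundle (𝓡 n) M))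
    (χ : DiffForm (𝓡 n).tangent (TangentBundle (𝓡 n) M) 1)
    (θ : DiffForm (𝓡 n).tangent (TangentBundle (𝓡 n) M) (2 * n - 2)) :
    DiffForm (𝓡 n) M (n - 1) :=
  fibreIntegral o U (by omega) (χ.wedgeOne θ)

end Fibre

end

/-!
On `U` put `α = χ ∧ θ`. As `dθ = 0` and `i_ℛ θ = 0`, also `ℒ_ℛ θ = 0`: the form `θ` is invariant
under the radial scalings `u ↦ eᵗ u`. Since fibre integration commutes with `d`, the form `d𝒥` is
the fibre integral of `dα`, and in polar coordinates of the fibre this is an integral over rays of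
`i_ℛ dα = ℒ_ℛ α - d i_ℛ α`, in which `i_ℛ α = χ(ℛ) θ` and `θ` is constant along the ray. The first
term is a total derivative along the ray, and the integral of `χ(ℛ)` over each ray is `1`, so that
the second contributes the differential of a constant. This requires the support of `α` to be proper
over the base. If only its intersection with each fibre is compact, then by Baire's theorem the
support is still proper over a dense open set of base points, and `d𝒥 = 0` extends to `M` by
continuity.
-/

noncomputable section

/-! ### Integrals depending on a parameter -/

section ParametricIntegral

variable {P G F F' : Type*} [NormedAddCommGroup P] [NormedSpace ℝ P] [NormedAddCommGroup G]
  [NormedSpace ℝ G] [NormedAddCommGroup F] [NormedSpace ℝ F] [NormedAddCommGroup F']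
  [NormedSpace ℝ F']

/-- The function `f` on `P × G` is of class `C^r` over a neighbourhood `s` of `x` in `P`, and its
support over `s` is contained in a tube `s × k` with `k` compact. This is what is needed to
differentiate `∫ f (p, y) dy` under the integral sign near `p = x`. -/
def ContDiffInTubeAt (r : WithTop ℕ∞) (f : P × G → F) (x : P) : Prop :=
  ∃ k : Set G, IsCompact k ∧
    ∀ᶠ p in 𝓝 x, (∀ y, ContDiffAt ℝ r f (p, y)) ∧ ∀ y ∉ k, f (p, y) = 0

namespace ContDiffInTubeAt

variable {r : WithTop ℕ∞} {f : P × G → F} {x : P}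

theorem eventually (hf : ContDiffInTubeAt r f x) : ∀ᶠ p in 𝓝 x, ContDiffInTubeAt r f p := by
  obtain ⟨k, hk, hfk⟩ := hf
  exact hfk.eventually_nhds.mono fun p hp => ⟨k, hk, hp⟩

theorem contDiffAt (hf : ContDiffInTubeAt r f x) (y : G) : ContDiffAt ℝ r f (x, y) :=
  let ⟨_, _, hfk⟩ := hf
  hfk.self_of_nhds.1 y

theorem differentiableAt (hf : ContDiffInTubeAt 1 f x) (y : G) : DifferentiableAt ℝ f (x, y) :=
  (hf.contDiffAt y).differentiableAt one_ne_zero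

theorem clm_comp (hf : ContDiffInTubeAt r f x) (L : F →L[ℝ] F') :
    ContDiffInTubeAt r (fun z => L (f z)) x := by
  obtain ⟨k, hk, hfk⟩ := hf
  refine ⟨k, hk, hfk.mono fun p hp => ⟨fun y => L.contDiff.contDiffAt.comp (p, y) (hp.1 y), ?_⟩⟩
  intro y hy
  simp only [hp.2 y hy, map_zero]

theorem continuous_fderiv (hf : ContDiffInTubeAt 1 f x) :
    Continuous fun y => fderiv ℝ f (x, y) :=
  continuous_iff_continuousAt.2 fun y =>
    ((hf.contDiffAt y).continuousAt_fderiv one_ne_zero).comp (f := fun y => (x, y)) (by fun_prop)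

theorem exists_isCompact_fderiv_eq_zero (hf : ContDiffInTubeAt r f x) :
    ∃ k : Set G, IsCompact k ∧ ∀ y ∉ k, fderiv ℝ f (x, y) = 0 := by
  obtain ⟨k, hk, hfk⟩ := hf
  refine ⟨k, hk, fun y hy => (hasFDerivAt_zero_of_eventually_const 0 ?_).fderiv⟩
  filter_upwards [hfk.prod_nhds (hk.isClosed.isOpen_compl.mem_nhds hy)] with q hq
  exact hq.1.2 q.2 hq.2

variable [MeasurableSpace G] [BorelSpace G] {μ : Measure G}

theorem integrable_fderiv [IsLocallyFiniteMeasure μ]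
    (hf : ContDiffInTubeAt 1 f x) : Integrable (fun y => fderiv ℝ f (x, y)) μ := by
  obtain ⟨k, hk, hfk⟩ := hf.exists_isCompact_fderiv_eq_zero
  exact hf.continuous_fderiv.integrable_of_hasCompactSupport (HasCompactSupport.intro hk hfk)

theorem integrable [IsLocallyFiniteMeasure μ]
    (hf : ContDiffInTubeAt r f x) : Integrable (fun y => f (x, y)) μ := by
  obtain ⟨k, hk, hfk⟩ := id hf
  have hcont : Continuous fun y => f (x, y) := continuous_iff_continuousAt.2 fun y =>
    (hf.contDiffAt y).continuousAt.comp (f := fun y => (x, y)) (by fun_prop)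
  exact hcont.integrable_of_hasCompactSupport (HasCompactSupport.intro hk hfk.self_of_nhds.2)

end ContDiffInTubeAt

variable [MeasurableSpace G] [BorelSpace G] {μ : Measure G} {f : P × G → F} {x : P}

theorem convolution_one_zero_eq_integral {G : Type*} [NormedAddCommGroup G] [MeasurableSpace G]
    [BorelSpace G] {μ : Measure G} [μ.IsNegInvariant] (g : G → F) :
    convolution (fun _ : G => (1 : ℝ)) g (ContinuousLinearMap.lsmul ℝ ℝ) μ 0 = ∫ y, g y ∂μ := by
  simpa [convolution] using integral_neg_eq_self g μ

namespace ContDiffInTubeAt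

/- Mathlib differentiates convolutions depending on a parameter; the integral of `f (p, ·)` is its
convolution with the constant function `1`, evaluated at `0`. -/

theorem contDiffAt_integral [μ.IsNegInvariant] [IsLocallyFiniteMeasure μ] {r : ℕ∞}
    (hf : ContDiffInTubeAt r f x) : ContDiffAt ℝ r (fun p => ∫ y, f (p, y) ∂μ) x := by
  obtain ⟨k, hk, hfk⟩ := hf
  obtain ⟨s, hs, hso, hxs⟩ := eventually_nhds_iff.1 hfk
  have hconv := contDiffOn_convolution_right_with_param_comp (μ := μ) (f := fun _ : G => (1 : ℝ))
    (g := fun p y => f (p, y)) (ContinuousLinearMap.lsmul ℝ ℝ : ℝ →L[ℝ] F →L[ℝ] F)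
    (v := fun _ : P => (0 : G)) contDiffOn_const hso hk (fun p y hp hy => (hs p hp).2 y hy)
    (locallyIntegrable_const 1) fun z hz => ((hs z.1 hz.1).1 z.2).contDiffWithinAt
  simp only [convolution_one_zero_eq_integral] at hconv
  exact hconv.contDiffAt (hso.mem_nhds hxs)

theorem fderiv_integral [μ.IsNegInvariant] [IsLocallyFiniteMeasure μ]
    (hf : ContDiffInTubeAt 1 f x) (v : P) :
    fderiv ℝ (fun p => ∫ y, f (p, y) ∂μ) x v = ∫ y, fderiv ℝ f (x, y) (v, 0) ∂μ := by
  have hint := hf.integrable_fderiv (μ := μ)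
  obtain ⟨k, hk, hfk⟩ := hf
  obtain ⟨s, hs, hso, hxs⟩ := eventually_nhds_iff.1 hfk
  have hconv := hasFDerivAt_convolution_right_with_param (μ := μ) (f := fun _ : G => (1 : ℝ))
    (g := fun p y => f (p, y)) (ContinuousLinearMap.lsmul ℝ ℝ : ℝ →L[ℝ] F →L[ℝ] F) hso hk
    (fun p y hp hy => (hs p hp).2 y hy) (locallyIntegrable_const 1)
    (fun z hz => ((hs z.1 hz.1).1 z.2).contDiffWithinAt) (x, 0) hxs
  have hderiv := hconv.comp (f := fun p : P => (p, (0 : G))) x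
    ((hasFDerivAt_id x).prodMk (hasFDerivAt_const (0 : G) x))
  have hprecomp : ∀ T : (P × G) →L[ℝ] F, (ContinuousLinearMap.precompR (P × G)
      (ContinuousLinearMap.lsmul ℝ ℝ : ℝ →L[ℝ] F →L[ℝ] F)) 1 T = T := fun T => by
    ext <;> simp [ContinuousLinearMap.precompR]
  have hvalue : convolution (fun _ : G => (1 : ℝ)) (fun y => fderiv ℝ f (x, y))
      (ContinuousLinearMap.precompR (P × G) (ContinuousLinearMap.lsmul ℝ ℝ)) μ 0 =
      ∫ y, fderiv ℝ f (x, y) ∂μ := by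
    simp only [convolution, zero_sub, hprecomp]
    exact integral_neg_eq_self (fun y => fderiv ℝ f (x, y)) μ
  simp only [Function.comp_def, convolution_one_zero_eq_integral] at hderiv
  rw [hderiv.fderiv, ContinuousLinearMap.comp_apply]
  refine (congrArg (fun T : (P × G) →L[ℝ] F => T (v, 0)) hvalue).trans ?_
  exact ContinuousLinearMap.integral_apply hint _

theorem integral_fderiv_eq_zero [FiniteDimensional ℝ G] [μ.IsAddHaarMeasure]
    (hf : ContDiffInTubeAt 1 f x) (e : G) : ∫ y, fderiv ℝ f (x, y) (0, e) ∂μ = 0 := by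
  have hslice (y : G) : HasFDerivAt (fun y => f (x, y))
      ((fderiv ℝ f (x, y)).comp (ContinuousLinearMap.inr ℝ P G)) y :=
    (hf.differentiableAt y).hasFDerivAt.comp (f := fun y => (x, y)) y (hasFDerivAt_prodMk_right x y)
  have hint : Integrable (fun y => fderiv ℝ f (x, y) (0, e)) μ :=
    hf.integrable_fderiv.apply_continuousLinearMap _
  have hfderiv (y : G) : fderiv ℝ (fun y => f (x, y)) y e = fderiv ℝ f (x, y) (0, e) := by
    rw [(hslice y).fderiv]
    simp
  have hparts := integral_smul_fderiv_eq_neg_fderiv_smul_of_integrable (μ := μ) (𝕜 := ℝ)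
    (f := fun _ : G => (1 : ℝ)) (g := fun y => f (x, y)) (v := e) (by simp)
    (by simpa only [one_smul, hfderiv] using hint) (by simpa using hf.integrable)
    (fun _ _ => differentiableAt_const _) (fun y _ => (hslice y).differentiableAt)
  simpa [hfderiv] using hparts

end ContDiffInTubeAt

end ParametricIntegral

/-! ### Integration along rays -/

section Polar

variable {G : Type*} [NormedAddCommGroup G] [NormedSpace ℝ G] [FiniteDimensional ℝ G]
  [Nontrivial G] [MeasurableSpace G] [BorelSpace G] (μ : Measure G) [μ.IsAddHaarMeasure]

theorem integral_volumeIoiPow {F : Type*} [NormedAddCommGroup F] [NormedSpace ℝ F] (d : ℕ)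
    (f : ℝ → F) :
    ∫ r, f r ∂Measure.volumeIoiPow d = ∫ r in Ioi (0 : ℝ), r ^ d • f r := by
  rw [Measure.volumeIoiPow]
  simp only [ENNReal.ofReal]
  rw [integral_withDensity_eq_integral_smul (measurable_subtype_coe.pow_const _).real_toNNReal,
    integral_subtype_comap measurableSet_Ioi fun r => Real.toNNReal (r ^ d) • f r]
  refine setIntegral_congr_fun measurableSet_Ioi fun r hr => ?_
  simp only [NNReal.smul_def, Real.coe_toNNReal _ (pow_nonneg (mem_Ioi.1 hr).le d)]

theorem integral_eq_integral_sphere_prod_Ioi {F : Type*} [NormedAddCommGroup F] [NormedSpace ℝ F]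
    (f : G → F) :
    ∫ y, f y ∂μ = ∫ z : Metric.sphere (0 : G) 1 × Ioi (0 : ℝ), f (z.2.1 • z.1.1)
      ∂μ.toSphere.prod (.volumeIoiPow (Module.finrank ℝ G - 1)) := by
  rw [← μ.measurePreserving_homeomorphUnitSphereProd.integral_comp
    (Homeomorph.measurableEmbedding _)]
  have hpolar (y : ({0}ᶜ : Set G)) : (homeomorphUnitSphereProd G y).2.1 •
      (homeomorphUnitSphereProd G y).1.1 = y :=
    congrArg Subtype.val ((homeomorphUnitSphereProd G).symm_apply_apply y)
  simp only [hpolar]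
  rw [integral_subtype_comap (measurableSet_singleton _).compl f, restrict_compl_singleton]

theorem integral_Ioi_zero_eq_integral_exp {F : Type*} [NormedAddCommGroup F] [NormedSpace ℝ F]
    (f : ℝ → F) : ∫ r in Ioi (0 : ℝ), f r = ∫ t : ℝ, Real.exp t • f (Real.exp t) := by
  have hsubst := integral_image_eq_integral_abs_deriv_smul (f := Real.exp) (f' := Real.exp)
    MeasurableSet.univ (fun t _ => (Real.hasDerivAt_exp t).hasDerivWithinAt)
    Real.exp_injective.injOn f
  rw [image_univ, Real.range_exp] at hsubst
  simpa [abs_of_pos (Real.exp_pos _)] using hsubst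

theorem integral_eq_zero_of_forall_integral_ray_eq_zero {F : Type*} [NormedAddCommGroup F]
    [NormedSpace ℝ F] {f : G → F}
    (hf : ∀ y ≠ 0, ∫ t : ℝ, Real.exp t ^ Module.finrank ℝ G • f (Real.exp t • y) = 0) :
    ∫ y, f y ∂μ = 0 := by
  rw [integral_eq_integral_sphere_prod_Ioi]
  by_cases hint : Integrable (fun z : Metric.sphere (0 : G) 1 × Ioi (0 : ℝ) => f (z.2.1 • z.1.1))
      (μ.toSphere.prod (.volumeIoiPow (Module.finrank ℝ G - 1)))
  · rw [integral_prod _ hint]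
    refine integral_eq_zero_of_ae (Eventually.of_forall fun y => ?_)
    have hy : (y : G) ≠ 0 := ne_zero_of_mem_unit_sphere y
    have hdim : Module.finrank ℝ G ≠ 0 := Module.finrank_pos.ne'
    simp only [Pi.zero_apply]
    rw [integral_volumeIoiPow _ fun r => f (r • (y : G)), integral_Ioi_zero_eq_integral_exp]
    simpa only [smul_smul, mul_pow_sub_one hdim] using hf y hy
  · exact integral_undef hint

end Polar

/-! ### Alternating maps -/

section Alternating

open ContinuousAlternatingMap

variable {V V' W F : Type*} [NormedAddCommGroup V] [NormedSpace ℝ V] [NormedAddCommGroup V']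
  [NormedSpace ℝ V'] [NormedAddCommGroup W] [NormedSpace ℝ W] [NormedAddCommGroup F]
  [NormedSpace ℝ F]

section Smoothness

variable [FiniteDimensional ℝ V]

/-- The values of an alternating map on families of vectors of a basis, as a linear function of
this alternating map. -/
def basisValues (V F : Type*) [NormedAddCommGroup V] [NormedSpace ℝ V] [FiniteDimensional ℝ V]
    [NormedAddCommGroup F] [NormedSpace ℝ F] (k : ℕ) :
    (V [⋀^Fin k]→L[ℝ] F) →ₗ[ℝ] ((Fin k → Fin (Module.finrank ℝ V)) → F) where
  toFun f s := f fun i => Module.finBasis ℝ V (s i)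
  map_add' _ _ := rfl
  map_smul' _ _ := rfl

theorem basisValues_injective (k : ℕ) : Function.Injective (basisValues V F k) := fun _ _ h =>
  toAlternatingMap_injective <|
    Module.Basis.ext_alternating (Module.finBasis ℝ V) fun s _ => congrFun h s

variable [FiniteDimensional ℝ F]

instance finiteDimensional_continuousAlternatingMap (k : ℕ) :
    FiniteDimensional ℝ (V [⋀^Fin k]→L[ℝ] F) :=
  Module.Finite.of_injective _ (basisValues_injective k)

theorem contDiffAt_of_forall_apply {k : ℕ} {r : WithTop ℕ∞} {f : W → V [⋀^Fin k]→L[ℝ] F} {x : W}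
    (hf : ∀ v, ContDiffAt ℝ r (fun w => f w v) x) : ContDiffAt ℝ r f x := by
  obtain ⟨p, hp⟩ := (basisValues V F k).exists_leftInverse_of_injective
    (LinearMap.ker_eq_bot.2 (basisValues_injective k))
  have hvalues : ContDiffAt ℝ r (fun w => basisValues V F k (f w)) x :=
    contDiffAt_pi.2 fun s => hf _
  have hf_eq : f = fun w => p.toContinuousLinearMap (basisValues V F k (f w)) :=
    funext fun w => (LinearMap.congr_fun hp (f w)).symm
  rw [hf_eq]
  exact p.toContinuousLinearMap.contDiff.contDiffAt.comp x hvalues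

theorem contDiffAt_compContinuousLinearMap {k : ℕ} {r : WithTop ℕ∞}
    {f : W → V' [⋀^Fin k]→L[ℝ] F} {g : W → V →L[ℝ] V'} {x : W} (hf : ContDiffAt ℝ r f x)
    (hg : ContDiffAt ℝ r g x) :
    ContDiffAt ℝ r (fun w => (f w).compContinuousLinearMap (g w)) x := by
  refine contDiffAt_of_forall_apply fun v => ?_
  have hcomp : ContDiffAt ℝ r (fun w =>
      ContinuousMultilinearMap.compContinuousLinearMapContinuousMultilinear ℝ (fun _ : Fin k => V)
        (fun _ : Fin k => V') F (fun _ => g w)) x :=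
    (ContinuousMultilinearMap.contDiff _).contDiffAt.comp x (contDiffAt_pi.2 fun _ => hg)
  have hmultilinear : ContDiffAt ℝ r (fun w => (f w).toContinuousMultilinearMap) x :=
    (toContinuousMultilinearMapLI (𝕜 := ℝ) (E := V') (F := F) (ι := Fin k)).contDiff.contDiffAt.comp
      x hf
  exact (ContinuousMultilinearMap.apply ℝ (fun _ : Fin k => V) F v).contDiff.contDiffAt.comp x
    (hcomp.clm_apply hmultilinear)

end Smoothness

theorem contDiffAt_continuousAlternatingMap_apply {k : ℕ} {r : WithTop ℕ∞}
    {f : W → V [⋀^Fin k]→L[ℝ] F} {x : W} (hf : ContDiffAt ℝ r f x) (v : Fin k → V) :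
    ContDiffAt ℝ r (fun w => f w v) x :=
  (ContinuousAlternatingMap.apply ℝ V F v).contDiff.contDiffAt.comp x hf

theorem map_eq_zero_of_mem_span {ι : Type*} (A : V [⋀^ι]→L[ℝ] F) (v : ι → V) (i : ι)
    (hi : v i ∈ Submodule.span ℝ (v '' {i}ᶜ)) : A v = 0 := by
  refine A.toAlternatingMap.map_linearDependent v fun h => ?_
  exact linearIndependent_iff_notMem_span.1 h i (by simpa [compl_eq_univ_sdiff] using hi)

theorem map_eq_zero_of_forall_snoc {k : ℕ} (A : V [⋀^Fin (k + 1)]→L[ℝ] F) {R : V}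
    (hA : ∀ w : Fin k → V, A (Fin.snoc w R) = 0) (v : Fin (k + 1) → V) (hv : ∃ i, v i = R) :
    A v = 0 := by
  obtain ⟨i, rfl⟩ := hv
  have hswap (hi : i ≠ Fin.last k) : A (v ∘ Equiv.swap i (Fin.last k)) = -A v :=
    A.toAlternatingMap.map_swap v hi
  have hlast (w : Fin (k + 1) → V) (hw : w (Fin.last k) = v i) : A w = 0 := by
    rw [← Fin.snoc_init_self w, hw]
    exact hA _
  by_cases hi : i = Fin.last k
  · exact hlast v (by rw [hi])
  · exact neg_eq_zero.1 ((hswap hi).symm.trans (hlast _ (by simp)))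

theorem eq_zero_of_finrank_eq_of_map_eq_zero [FiniteDimensional ℝ V] {d : ℕ}
    (hd : Module.finrank ℝ V = d) {Ω : V [⋀^Fin d]→L[ℝ] F} {R : V} (hR : R ≠ 0)
    (hΩ : ∀ v, (∃ i, v i = R) → Ω v = 0) : Ω = 0 := by
  ext v
  by_cases hv : LinearIndependent ℝ v
  · let b := basisOfLinearIndependentOfCardEqFinrank' v hv (by simp [hd])
    have hbv : ⇑b = v := coe_basisOfLinearIndependentOfCardEqFinrank' v hv _
    obtain ⟨i, hi⟩ : ∃ i, b.repr R i ≠ 0 := by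
      by_contra! hzero
      exact hR (b.ext_elem (by simpa using hzero))
    have hexpand : Ω (Function.update v i R) = b.repr R i • Ω v := by
      have hsum := Ω.toAlternatingMap.map_update_sum Finset.univ i (fun j => b.repr R j • b j) v
      rw [b.sum_repr R, hbv] at hsum
      refine hsum.trans ((Finset.sum_eq_single i ?_ ?_).trans ?_)
      · intro j _ hj
        exact (Ω.map_update_smul v i _ _).trans <|
          smul_eq_zero_of_right _ (Ω.toAlternatingMap.map_update_self v hj.symm)
      · simp
      · exact (Ω.map_update_smul v i _ _).trans (by rw [Function.update_eq_self])
    rw [hΩ _ ⟨i, Function.update_self ..⟩] at hexpand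
    simpa [hi] using hexpand.symm
  · exact Ω.toAlternatingMap.map_linearDependent v hv

end Alternating

/-! ### Contraction and wedge product -/

section Contraction

open ContinuousAlternatingMap

variable {V V' V'' W : Type*} [NormedAddCommGroup V] [NormedSpace ℝ V] [NormedAddCommGroup V']
  [NormedSpace ℝ V'] [NormedAddCommGroup V''] [NormedSpace ℝ V''] [NormedAddCommGroup W]
  [NormedSpace ℝ W]

/-- The family `v₁, …, v_k, e₁, …, e_m`, with a free choice of the expression `q` for the length
`k + m`: these are the arguments of a form in `contractLast`. -/
def appendArgs {X : Type*} {q k m : ℕ} (hq : q = k + m) (v : Fin k → X) (e : Fin m → X) :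
    Fin q → X :=
  fun l => Fin.append v e (Fin.cast hq l)

theorem comp_appendArgs {X X' : Type*} {q k m : ℕ} (hq : q = k + m) (f : X → X') (v : Fin k → X)
    (e : Fin m → X) : f ∘ appendArgs hq v e = appendArgs hq (f ∘ v) (f ∘ e) := by
  subst hq
  funext l
  exact Fin.addCases (fun i => by simp [appendArgs]) (fun j => by simp [appendArgs]) l

theorem appendArgs_const {X : Type*} {k : ℕ} (v : Fin k → X) (R : X) :
    appendArgs rfl v (fun _ : Fin 1 => R) = Fin.snoc v R :=
  Fin.append_right_eq_snoc v _

theorem removeNth_appendArgs {X : Type*} {q m n : ℕ} (hq : q = m + n) (hq' : q + 1 = m + 1 + n)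
    (v : Fin (m + 1) → X) (e : Fin n → X) (i : Fin (m + 1)) :
    (Fin.cast hq'.symm (Fin.castAdd n i)).removeNth (appendArgs hq' v e) =
      appendArgs hq (i.removeNth v) e := by
  subst hq
  funext l
  refine Fin.addCases (fun j => ?_) (fun j => ?_) l
  · have hj : Fin.cast hq' ((Fin.cast hq'.symm (Fin.castAdd n i)).succAbove (Fin.castAdd n j)) =
        Fin.castAdd n (i.succAbove j) := by
      ext
      simp only [Fin.succAbove, Fin.lt_def, Fin.val_cast, Fin.val_castSucc, Fin.val_castAdd]
      split_ifs <;> simp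
    simp [Fin.removeNth, appendArgs, hj]
  · have hj : Fin.cast hq' ((Fin.cast hq'.symm (Fin.castAdd n i)).succAbove (Fin.natAdd m j)) =
        Fin.natAdd (m + 1) j := by
      ext
      simp only [Fin.succAbove, Fin.lt_def, Fin.val_cast, Fin.val_castSucc, Fin.val_castAdd,
        Fin.val_natAdd]
      split_ifs
      · omega
      · simp only [Fin.val_succ, Fin.val_natAdd]; omega
    simp [Fin.removeNth, appendArgs, hj]

theorem contractLast_compContinuousLinearMap {q k m : ℕ} (hq : q = k + m) (A : V [⋀^Fin q]→L[ℝ] ℝ)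
    (D : V' →L[ℝ] V) (L : V'' →L[ℝ] V') (e : Fin m → V') :
    contractLast hq (A.compContinuousLinearMap D) L e =
      contractLast hq A (D ∘L L) (fun i => D (e i)) := by
  ext v
  exact congrArg A (comp_appendArgs hq D _ _)

/-- `contractLast hq A L e` as a linear function of `A`. -/
def contractLastCLM [FiniteDimensional ℝ V] {q k m : ℕ} (hq : q = k + m) (L : V' →L[ℝ] V)
    (e : Fin m → V) : (V [⋀^Fin q]→L[ℝ] ℝ) →L[ℝ] (V' [⋀^Fin k]→L[ℝ] ℝ) :=
  LinearMap.toContinuousLinearMap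
    { toFun := fun A => contractLast hq A L e
      map_add' := fun _ _ => rfl
      map_smul' := fun _ _ => rfl }

theorem map_appendArgs_eq_zero_of_mem_span {q k m : ℕ} (hq : q = k + m) (A : V [⋀^Fin q]→L[ℝ] ℝ)
    (v : Fin k → V) (e : Fin m → V) (i : Fin k) (hi : v i ∈ Submodule.span ℝ (range e)) :
    A (appendArgs hq v e) = 0 := by
  subst hq
  refine map_eq_zero_of_mem_span A _ (Fin.castAdd m i) ?_
  simp only [appendArgs, Fin.cast_eq_self, Fin.append_left]
  refine Submodule.span_mono ?_ hi
  rintro _ ⟨j, rfl⟩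
  refine ⟨Fin.natAdd k j, ?_, Fin.append_right v e j⟩
  simp only [mem_compl_iff, mem_singleton_iff, Fin.ext_iff, Fin.val_natAdd, Fin.val_castAdd]
  omega

theorem contractLast_congr_of_sub_mem_span {q k m : ℕ} (hq : q = k + m) (A : V [⋀^Fin q]→L[ℝ] ℝ)
    {L L' : V' →L[ℝ] V} {e : Fin m → V} (h : ∀ v, L v - L' v ∈ Submodule.span ℝ (range e)) :
    contractLast hq A L e = contractLast hq A L' e := by
  ext v
  have hadd := (contractLast hq A (ContinuousLinearMap.id ℝ V) e).toMultilinearMap.map_add_univ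
    (fun i => L' (v i)) (fun i => L (v i) - L' (v i))
  have hL : (fun i => L' (v i)) + (fun i => L (v i) - L' (v i)) = fun i => L (v i) :=
    add_sub_cancel _ _
  rw [hL] at hadd
  refine hadd.trans ((Finset.sum_eq_single Finset.univ ?_ (by simp)).trans ?_)
  · intro s _ hs
    obtain ⟨i, hi⟩ : ∃ i, i ∉ s := by
      by_contra! hmem
      exact hs (Finset.eq_univ_iff_forall.2 hmem)
    refine map_appendArgs_eq_zero_of_mem_span hq A _ e i ?_
    simpa [Finset.piecewise_eq_of_notMem _ _ _ hi] using h (v i)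
  · simp only [Finset.piecewise_univ]
    rfl

theorem contractLast_det {q k m : ℕ} (hq : q = k + m) (A : V [⋀^Fin q]→L[ℝ] ℝ) (L : V'' →L[ℝ] V)
    (b : Module.Basis (Fin m) ℝ V') (S : V' →ₗ[ℝ] V) (T : V' →ₗ[ℝ] V') :
    contractLast hq A L (fun i => S (T (b i))) =
      LinearMap.det T • contractLast hq A L (fun i => S (b i)) := by
  subst hq
  ext v
  let flipped : V [⋀^Fin (m + k)]→L[ℝ] ℝ :=
    { A.toAlternatingMap.domDomCongr finAddFlip with cont := A.cont.comp (by fun_prop) }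
  have hflip (e : Fin m → V) : contractLast rfl flipped (ContinuousLinearMap.id ℝ V)
      (fun i => L (v i)) e = contractLast rfl A L e v := by
    refine congrArg A (funext fun l => ?_)
    exact Fin.addCases (fun i => by simp) (fun j => by simp) l
  have hdet := DFunLike.congr_fun (AlternatingMap.eq_smul_basis_det b
    ((contractLast rfl flipped (ContinuousLinearMap.id ℝ V)
      (fun i => L (v i))).toAlternatingMap.compLinearMap S)) (T ∘ b)
  have hbT : b.det (T ∘ b) = LinearMap.det T := by
    rw [b.det_comp, b.det_self, mul_one]
  refine (hflip _).symm.trans (hdet.trans ?_)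
  rw [AlternatingMap.smul_apply, hbT, smul_eq_mul, mul_comm]
  exact congrArg (LinearMap.det T * ·) (hflip fun i => S (b i))

theorem alternatizeUncurryFin_appendArgs {q m n : ℕ} (hq : q = m + n) (hq' : q + 1 = m + 1 + n)
    (L : V →L[ℝ] V [⋀^Fin q]→L[ℝ] ℝ) (v : Fin (m + 1) → V) (e : Fin n → V) :
    alternatizeUncurryFin L (appendArgs hq' v e) =
      ∑ i : Fin (m + 1), (-1 : ℝ) ^ (i : ℕ) * L (v i) (appendArgs hq (i.removeNth v) e) +
        ∑ j : Fin n, (-1 : ℝ) ^ (m + 1 + j : ℕ) *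
          L (e j) ((Fin.cast hq'.symm (Fin.natAdd (m + 1) j)).removeNth (appendArgs hq' v e)) := by
  rw [alternatizeUncurryFin_apply, ← Equiv.sum_comp (finCongr hq'.symm), Fin.sum_univ_add]
  congr 1
  · refine Finset.sum_congr rfl fun i _ => ?_
    rw [finCongr_apply, removeNth_appendArgs hq hq']
    simp [appendArgs]
  · refine Finset.sum_congr rfl fun j _ => ?_
    rw [finCongr_apply]
    simp [appendArgs]

/-- The wedge product `χ ∧ θ` of a `1`-form and a `k`-form on a vector space, with the sign
convention of `DiffForm.wedgeOne`. -/
def wedgeOneForm {k : ℕ} (χ : V [⋀^Fin 1]→L[ℝ] ℝ) (θ : V [⋀^Fin k]→L[ℝ] ℝ) :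
    V [⋀^Fin (k + 1)]→L[ℝ] ℝ :=
  alternatizeUncurryFin (((ofSubsingleton ℝ V ℝ (0 : Fin 1)).symm χ).smulRight θ)

theorem wedgeOneForm_apply {k : ℕ} (χ : V [⋀^Fin 1]→L[ℝ] ℝ) (θ : V [⋀^Fin k]→L[ℝ] ℝ)
    (v : Fin (k + 1) → V) :
    wedgeOneForm χ θ v =
      ∑ i : Fin (k + 1), (-1 : ℝ) ^ (i : ℕ) * (χ (fun _ => v i) * θ (i.removeNth v)) := by
  simp [wedgeOneForm, alternatizeUncurryFin_apply]

theorem wedgeOneForm_compContinuousLinearMap {k : ℕ} (χ : V [⋀^Fin 1]→L[ℝ] ℝ)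
    (θ : V [⋀^Fin k]→L[ℝ] ℝ) (L : V' →L[ℝ] V) :
    (wedgeOneForm χ θ).compContinuousLinearMap L =
      wedgeOneForm (χ.compContinuousLinearMap L) (θ.compContinuousLinearMap L) := by
  ext v
  simp only [compContinuousLinearMap_apply, wedgeOneForm_apply]
  rfl

theorem wedgeOneForm_snoc {k : ℕ} (χ : V [⋀^Fin 1]→L[ℝ] ℝ) {θ : V [⋀^Fin k]→L[ℝ] ℝ} {R : V}
    (hθ : ∀ v : Fin k → V, (∃ i, v i = R) → θ v = 0) (w : Fin k → V) :
    wedgeOneForm χ θ (Fin.snoc w R) = (-1) ^ k * (χ (fun _ => R) * θ w) := by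
  rw [wedgeOneForm_apply, Fin.sum_univ_castSucc, Finset.sum_eq_zero, zero_add]
  · simp
  · intro i _
    obtain ⟨j, hj⟩ : ∃ j, i.castSucc.succAbove j = Fin.last k :=
      Fin.exists_succAbove_eq (Fin.castSucc_lt_last i).ne'
    rw [hθ _ ⟨j, by rw [Fin.removeNth, hj, Fin.snoc_last]⟩, mul_zero, mul_zero]

theorem contDiffAt_wedgeOneForm [FiniteDimensional ℝ V] {k : ℕ} {r : WithTop ℕ∞}
    {χ : W → V [⋀^Fin 1]→L[ℝ] ℝ} {θ : W → V [⋀^Fin k]→L[ℝ] ℝ} {x : W}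
    (hχ : ContDiffAt ℝ r χ x) (hθ : ContDiffAt ℝ r θ x) :
    ContDiffAt ℝ r (fun w => wedgeOneForm (χ w) (θ w)) x := by
  refine contDiffAt_of_forall_apply fun v => ?_
  simp only [wedgeOneForm_apply]
  exact ContDiffAt.sum fun i _ => contDiffAt_const.mul <|
    (contDiffAt_continuousAlternatingMap_apply hχ _).mul
      (contDiffAt_continuousAlternatingMap_apply hθ _)

end Contraction

/-! ### Fibre integration on a product -/

section ProductFibreIntegral

open ContinuousAlternatingMap

/-- The pull-back `Φ^* α` of a differential form on a vector space. -/
def formPullback {V W : Type*} [NormedAddCommGroup V] [NormedSpace ℝ V] [NormedAddCommGroup W]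
    [NormedSpace ℝ W] {k : ℕ} (Φ : W → V) (α : V → V [⋀^Fin k]→L[ℝ] ℝ) (w : W) :
    W [⋀^Fin k]→L[ℝ] ℝ :=
  (α (Φ w)).compContinuousLinearMap (fderiv ℝ Φ w)

section Pullback

variable {V W : Type*} [NormedAddCommGroup V] [NormedSpace ℝ V] [NormedAddCommGroup W]
  [NormedSpace ℝ W] {k : ℕ} {Φ : W → V} {α : V → V [⋀^Fin k]→L[ℝ] ℝ} {w : W}

theorem contDiffAt_formPullback [FiniteDimensional ℝ W] {r r' : WithTop ℕ∞}
    (hα : ContDiffAt ℝ r α (Φ w)) (hΦ : ContDiffAt ℝ r' Φ w) (hr : r + 1 ≤ r') :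
    ContDiffAt ℝ r (formPullback Φ α) w :=
  contDiffAt_compContinuousLinearMap (hα.comp w (hΦ.of_le (le_self_add.trans hr)))
    (hΦ.fderiv_right hr)

theorem extDeriv_formPullback (hα : DifferentiableAt ℝ α (Φ w)) (hΦ : ContDiffAt ℝ 2 Φ w) :
    extDeriv (formPullback Φ α) w = formPullback Φ (extDeriv α) w :=
  extDeriv_pullback hα hΦ minSmoothness_of_isRCLikeNormedField.le

end Pullback

variable {X Y : Type*} [NormedAddCommGroup X] [NormedSpace ℝ X] [NormedAddCommGroup Y]
  [NormedSpace ℝ Y] {q k n : ℕ}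

/-- The integral of the form `α` on `X × Y` along the fibres of `X × Y → X`, the vectors `e` filling
the last slots of `α`. -/
def prodFibreIntegral [MeasurableSpace Y] (hq : q = k + n) (e : Fin n → Y) (μ : Measure Y)
    (α : X × Y → (X × Y) [⋀^Fin q]→L[ℝ] ℝ) (x : X) : X [⋀^Fin k]→L[ℝ] ℝ :=
  ∫ y, contractLast hq (α (x, y)) (ContinuousLinearMap.inl ℝ X Y) (fun i => (0, e i)) ∂μ

variable [FiniteDimensional ℝ Y] [MeasurableSpace Y] {μ : Measure Y}
  {α : X × Y → (X × Y) [⋀^Fin q]→L[ℝ] ℝ} {x : X}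

theorem prodFibreIntegral_apply [FiniteDimensional ℝ X] (hq : q = k + n) (e : Fin n → Y)
    (hα : Integrable (fun y => α (x, y)) μ) (v : Fin k → X) :
    prodFibreIntegral hq e μ α x v =
      ∫ y, α (x, y) (appendArgs hq (fun i => (v i, 0)) (fun i => (0, e i))) ∂μ :=
  ((ContinuousAlternatingMap.apply ℝ X ℝ v).integral_comp_comm <|
    (contractLastCLM hq (ContinuousLinearMap.inl ℝ X Y)
      (fun i => ((0 : X), e i))).integrable_comp hα).symm

variable [BorelSpace Y] [μ.IsAddHaarMeasure]

theorem integral_fderiv_vertical_apply_eq_zero (hα : ContDiffInTubeAt 1 α x) (e : Y)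
    (v : Fin q → X × Y) : ∫ y, fderiv ℝ α (x, y) (0, e) v ∂μ = 0 := by
  let evaluation := ContinuousAlternatingMap.apply ℝ (X × Y) ℝ v
  rw [← (hα.clm_comp evaluation).integral_fderiv_eq_zero (μ := μ) e]
  exact integral_congr_ae <| Eventually.of_forall fun y => .symm <| DFunLike.congr_fun
    (evaluation.hasFDerivAt.comp (x, y) (hα.differentiableAt y).hasFDerivAt).fderiv (0, e)

theorem ContDiffInTubeAt.integrable_extDeriv (hα : ContDiffInTubeAt 1 α x) :
    Integrable (fun y => extDeriv α (x, y)) μ :=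
  (alternatizeUncurryFinCLM ℝ (X × Y) ℝ).integrable_comp hα.integrable_fderiv

variable [FiniteDimensional ℝ X]

theorem contDiffAt_prodFibreIntegral {r : ℕ∞} (hq : q = k + n) (e : Fin n → Y)
    (hα : ContDiffInTubeAt r α x) : ContDiffAt ℝ r (prodFibreIntegral hq e μ α) x :=
  (hα.clm_comp (contractLastCLM hq (ContinuousLinearMap.inl ℝ X Y)
    (fun i => ((0 : X), e i)))).contDiffAt_integral

theorem fderiv_prodFibreIntegral_apply (hq : q = k + n) (e : Fin n → Y)
    (hα : ContDiffInTubeAt 1 α x) (u : X) (v : Fin k → X) :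
    fderiv ℝ (prodFibreIntegral hq e μ α) x u v =
      ∫ y, fderiv ℝ α (x, y) (u, 0) (appendArgs hq (fun i => (v i, 0)) (fun i => (0, e i))) ∂μ := by
  let C := contractLastCLM hq (ContinuousLinearMap.inl ℝ X Y) (fun i => ((0 : X), e i))
  have hderiv (y : Y) :
      fderiv ℝ (fun z => C (α z)) (x, y) (u, 0) = C (fderiv ℝ α (x, y) (u, 0)) :=
    DFunLike.congr_fun (C.hasFDerivAt.comp (x, y) (hα.differentiableAt y).hasFDerivAt).fderiv (u, 0)
  have hint : Integrable (fun y => C (fderiv ℝ α (x, y) (u, 0))) μ :=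
    C.integrable_comp (hα.integrable_fderiv.apply_continuousLinearMap _)
  have hfderiv := (hα.clm_comp C).fderiv_integral (μ := μ) u
  simp only [hderiv] at hfderiv
  exact (congrArg (fun A => A v) hfderiv).trans
    ((ContinuousAlternatingMap.apply ℝ X ℝ v).integral_comp_comm hint).symm

theorem extDeriv_prodFibreIntegral (hq : q = k + n) (hq' : q + 1 = k + 1 + n) (e : Fin n → Y)
    (hα : ContDiffInTubeAt 1 α x) :
    extDeriv (prodFibreIntegral hq e μ α) x = prodFibreIntegral hq' e μ (extDeriv α) x := by
  have hint (u : X × Y) (v : Fin q → X × Y) : Integrable (fun y => fderiv ℝ α (x, y) u v) μ :=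
    (ContinuousAlternatingMap.apply ℝ (X × Y) ℝ v).integrable_comp
      (hα.integrable_fderiv.apply_continuousLinearMap u)
  ext v
  rw [prodFibreIntegral_apply hq' e hα.integrable_extDeriv]
  simp only [extDeriv, alternatizeUncurryFin_appendArgs hq hq']
  rw [integral_add (integrable_finsetSum _ fun i _ => (hint _ _).const_mul _)
    (integrable_finsetSum _ fun i _ => (hint _ _).const_mul _),
    integral_finsetSum _ fun i _ => (hint _ _).const_mul _,
    integral_finsetSum _ fun i _ => (hint _ _).const_mul _]
  simp only [integral_const_mul, integral_fderiv_vertical_apply_eq_zero hα, mul_zero,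
    Finset.sum_const_zero, add_zero, alternatizeUncurryFin_apply]
  refine Finset.sum_congr rfl fun i _ => ?_
  rw [fderiv_prodFibreIntegral_apply hq e hα, zsmul_eq_mul, Int.cast_pow, Int.cast_neg,
    Int.cast_one]
  rfl

end ProductFibreIntegral

/-! ### The radial flow -/

section RadialFlow

open ContinuousAlternatingMap

variable {X Y : Type*} [NormedAddCommGroup X] [NormedSpace ℝ X] [NormedAddCommGroup Y]
  [NormedSpace ℝ Y]

/-- The scaling `(x, y) ↦ (x, e^t y)` of the fibres of `X × Y → X`. -/
def radialScaling (X Y : Type*) [NormedAddCommGroup X] [NormedSpace ℝ X] [NormedAddCommGroup Y]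
    [NormedSpace ℝ Y] (t : ℝ) : X × Y →L[ℝ] X × Y :=
  (ContinuousLinearMap.id ℝ X).prodMap (Real.exp t • ContinuousLinearMap.id ℝ Y)

/-- The flow `(z, t) ↦ radialScaling t z` of the radial vector field `(x, y) ↦ (0, y)`. -/
def radialFlow (p : (X × Y) × ℝ) : X × Y := radialScaling X Y p.2 p.1

theorem radialScaling_apply (t : ℝ) (z : X × Y) :
    radialScaling X Y t z = (z.1, Real.exp t • z.2) := rfl

theorem radialScaling_neg_radialScaling (t : ℝ) (z : X × Y) :
    radialScaling X Y (-t) (radialScaling X Y t z) = z := by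
  simp [radialScaling_apply, smul_smul, ← Real.exp_add]

theorem contDiff_radialFlow {r : WithTop ℕ∞} : ContDiff ℝ r (radialFlow : (X × Y) × ℝ → X × Y) :=
  (contDiff_fst.comp contDiff_fst).prodMk
    ((Real.contDiff_exp.comp contDiff_snd).smul (contDiff_snd.comp contDiff_fst))

theorem fderiv_radialFlow_apply (z : X × Y) (t : ℝ) (w : X × Y) (a : ℝ) :
    fderiv ℝ (radialFlow : (X × Y) × ℝ → X × Y) (z, t) (w, a) =
      radialScaling X Y t (w + a • (0, z.2)) := by
  have hexp : HasFDerivAt (fun p : (X × Y) × ℝ => Real.exp p.2)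
      (Real.exp t • ContinuousLinearMap.snd ℝ (X × Y) ℝ) (z, t) :=
    (hasFDerivAt_snd (𝕜 := ℝ) (p := (z, t))).exp
  have hfst : HasFDerivAt (fun p : (X × Y) × ℝ => p.1.1)
      ((ContinuousLinearMap.fst ℝ X Y).comp (ContinuousLinearMap.fst ℝ (X × Y) ℝ)) (z, t) :=
    ((ContinuousLinearMap.fst ℝ X Y).comp (ContinuousLinearMap.fst ℝ (X × Y) ℝ)).hasFDerivAt
  have hsnd : HasFDerivAt (fun p : (X × Y) × ℝ => p.1.2)
      ((ContinuousLinearMap.snd ℝ X Y).comp (ContinuousLinearMap.fst ℝ (X × Y) ℝ)) (z, t) :=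
    ((ContinuousLinearMap.snd ℝ X Y).comp (ContinuousLinearMap.fst ℝ (X × Y) ℝ)).hasFDerivAt
  have hflow : HasFDerivAt (radialFlow : (X × Y) × ℝ → X × Y) _ (z, t) :=
    hfst.prodMk (hexp.smul hsnd)
  rw [hflow.fderiv]
  ext
  · simp [radialScaling_apply]
  · simp [radialScaling_apply, smul_smul, mul_comm]

theorem fderiv_radialFlow_space (z : X × Y) (t : ℝ) (w : X × Y) :
    fderiv ℝ (radialFlow : (X × Y) × ℝ → X × Y) (z, t) (w, 0) = radialScaling X Y t w := by
  simp only [fderiv_radialFlow_apply, zero_smul, add_zero]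

theorem fderiv_radialFlow_time (z : X × Y) (t : ℝ) :
    fderiv ℝ (radialFlow : (X × Y) × ℝ → X × Y) (z, t) (0, 1) = (0, (radialScaling X Y t z).2) := by
  simp [fderiv_radialFlow_apply, radialScaling_apply]

theorem exists_isCompact_forall_exp_smul_notMem {C : Set Y} (hC : IsCompact C)
    (hC0 : (0 : Y) ∉ C) {y : Y} (hy : y ≠ 0) :
    ∃ K : Set ℝ, IsCompact K ∧ ∀ᶠ y' in 𝓝 y, ∀ t ∉ K, Real.exp t • y' ∉ C := by
  have hy_norm : 0 < ‖y‖ := norm_pos_iff.2 hy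
  obtain ⟨a, ha, haC⟩ : ∃ a > 0, ∀ c ∈ C, a ≤ ‖c‖ := by
    obtain ⟨a, ha, hball⟩ := Metric.isOpen_iff.1 hC.isClosed.isOpen_compl 0 hC0
    exact ⟨a, ha, fun c hc => not_lt.1 fun hlt => hball (by simpa using hlt) hc⟩
  obtain ⟨b, hb, hbC⟩ := hC.isBounded.exists_pos_norm_le
  refine ⟨Icc (Real.log (a / (2 * ‖y‖))) (Real.log (b / (‖y‖ / 2))), isCompact_Icc, ?_⟩
  filter_upwards [continuous_norm.continuousAt.eventually
    (Ioo_mem_nhds (half_lt_self hy_norm) (lt_two_mul_self hy_norm))] with y' hy' t ht hmem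
  have hnorm : ‖Real.exp t • y'‖ = Real.exp t * ‖y'‖ := by simp [norm_smul]
  have hexp := Real.exp_pos t
  have hlower := hnorm ▸ haC _ hmem
  have hupper := hnorm ▸ hbC _ hmem
  refine ht ⟨?_, ?_⟩
  · rw [Real.log_le_iff_le_exp (by positivity), div_le_iff₀ (by positivity)]
    nlinarith [hy'.2]
  · rw [Real.le_log_iff_exp_le (by positivity), le_div_iff₀ (by positivity)]
    nlinarith [hy'.1]

theorem fderiv_apply_eq_zero_of_extDeriv_eq_zero {V : Type*} [NormedAddCommGroup V]
    [NormedSpace ℝ V] {k : ℕ} {β : V → V [⋀^Fin k]→L[ℝ] ℝ} {z u : V} (hβ : DifferentiableAt ℝ β z)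
    (hd : extDeriv β z = 0) (hu : ∀ᶠ z' in 𝓝 z, ∀ v, (∃ i, v i = u) → β z' v = 0) :
    fderiv ℝ β z u = 0 := by
  ext w
  let args : Fin (k + 1) → V := Fin.cons u w
  have hexpand := DFunLike.congr_fun hd args
  rw [extDeriv, alternatizeUncurryFin_apply, Fin.sum_univ_succ, Finset.sum_eq_zero, add_zero]
    at hexpand
  · simpa [args] using hexpand
  · intro i _
    have hzero : (fun z' => β z' (i.succ.removeNth args)) =ᶠ[𝓝 z] fun _ => 0 := by
      filter_upwards [hu] with z' hz'
      exact hz' _ ⟨⟨0, i.pos⟩, by simp [Fin.removeNth, Fin.succAbove, Fin.lt_def, args]⟩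
    have hderiv : HasFDerivAt (fun z' => β z' (i.succ.removeNth args)) _ z :=
      (ContinuousAlternatingMap.apply ℝ V ℝ (i.succ.removeNth args)).hasFDerivAt.comp z
        hβ.hasFDerivAt
    have hderiv_zero := hderiv.unique (hasFDerivAt_zero_of_eventually_const 0 hzero)
    exact smul_eq_zero_of_right _ (DFunLike.congr_fun hderiv_zero (args i.succ))

/-- The form `θ` on the open set `O` is closed and annihilated by the radial vector field, and `O`
is invariant under the radial flow. -/
structure IsClosedRadiallyHorizontalOn {k : ℕ} (θ : X × Y → (X × Y) [⋀^Fin k]→L[ℝ] ℝ)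
    (O : Set (X × Y)) : Prop where
  isOpen : IsOpen O
  radialScaling_mem : ∀ z ∈ O, ∀ t, radialScaling X Y t z ∈ O
  contDiffAt : ∀ z ∈ O, ContDiffAt ℝ 1 θ z
  extDeriv_eq_zero : ∀ z ∈ O, extDeriv θ z = 0
  map_eq_zero : ∀ z ∈ O, ∀ v, (∃ i, v i = (0, z.2)) → θ z v = 0

theorem formPullback_radialFlow_snoc {k : ℕ} (α : X × Y → (X × Y) [⋀^Fin (k + 1)]→L[ℝ] ℝ)
    (z : X × Y) (t : ℝ) (w : Fin k → X × Y) :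
    formPullback radialFlow α (z, t) (Fin.snoc (fun i => (w i, 0)) (0, 1)) =
      α (radialScaling X Y t z)
        (Fin.snoc (radialScaling X Y t ∘ w) (0, (radialScaling X Y t z).2)) := by
  refine congrArg (α _) (funext fun l => ?_)
  refine Fin.lastCases ?_ (fun i => ?_) l
  · simp [fderiv_radialFlow_time]
  · simp [fderiv_radialFlow_space]

theorem extDeriv_formPullback_radialFlow {k : ℕ} {α : X × Y → (X × Y) [⋀^Fin k]→L[ℝ] ℝ}
    {z : X × Y} {t : ℝ} (hα : DifferentiableAt ℝ α (radialScaling X Y t z)) :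
    extDeriv (formPullback radialFlow α) (z, t) = formPullback radialFlow (extDeriv α) (z, t) :=
  extDeriv_formPullback (w := (z, t)) hα contDiff_radialFlow.contDiffAt

theorem exp_pow_mul_apply_appendArgs {k m n : ℕ} (hq : k = m + n) (b : Module.Basis (Fin n) ℝ Y)
    (A : (X × Y) [⋀^Fin k]→L[ℝ] ℝ) (v : Fin m → X) (t : ℝ) :
    Real.exp t ^ n * A (appendArgs hq (fun i => (v i, 0)) (fun i => (0, b i))) =
      A (radialScaling X Y t ∘ appendArgs hq (fun i => (v i, 0)) (fun i => (0, b i))) := by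
  have hdet := contractLast_det hq A (ContinuousLinearMap.inl ℝ X Y) b (LinearMap.inr ℝ X Y)
    (Real.exp t • LinearMap.id)
  rw [LinearMap.det_smul, LinearMap.det_id, mul_one, Module.finrank_eq_card_basis b,
    Fintype.card_fin] at hdet
  rw [comp_appendArgs]
  refine (DFunLike.congr_fun hdet v).symm.trans
    (congrArg₂ (fun v e => A (appendArgs hq v e)) (funext fun i => ?_) (funext fun i => ?_))
  all_goals simp [radialScaling_apply]

theorem snd_ne_zero_of_integral_eq_one {χ : X × Y → (X × Y) [⋀^Fin 1]→L[ℝ] ℝ} {z : X × Y}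
    (hχ : ∫ t : ℝ, χ (radialScaling X Y t z) (fun _ => (0, (radialScaling X Y t z).2)) = 1) :
    z.2 ≠ 0 := by
  intro hz
  have hzero (A : (X × Y) [⋀^Fin 1]→L[ℝ] ℝ) : A (fun _ => (0, 0)) = 0 := A.map_coord_zero 0 rfl
  simp [radialScaling_apply, hz, hzero] at hχ

variable [FiniteDimensional ℝ X] [FiniteDimensional ℝ Y]

theorem contDiffAt_formPullback_radialFlow {k : ℕ} {α : X × Y → (X × Y) [⋀^Fin k]→L[ℝ] ℝ}
    {r : WithTop ℕ∞} {z : X × Y} {t : ℝ} (hα : ContDiffAt ℝ r α (radialScaling X Y t z)) :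
    ContDiffAt ℝ r (formPullback radialFlow α) (z, t) :=
  contDiffAt_formPullback (w := (z, t)) hα contDiff_radialFlow.contDiffAt le_rfl

namespace IsClosedRadiallyHorizontalOn

variable {k : ℕ} {θ : X × Y → (X × Y) [⋀^Fin k]→L[ℝ] ℝ} {O : Set (X × Y)}

theorem fderiv_formPullback_time (hθ : IsClosedRadiallyHorizontalOn θ O) {z : X × Y}
    (hz : z ∈ O) (t : ℝ) : fderiv ℝ (formPullback radialFlow θ) (z, t) (0, 1) = 0 := by
  have hθz := hθ.contDiffAt _ (hθ.radialScaling_mem z hz t)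
  refine fderiv_apply_eq_zero_of_extDeriv_eq_zero
    ((contDiffAt_formPullback_radialFlow hθz).differentiableAt one_ne_zero) ?_ ?_
  · rw [extDeriv_formPullback_radialFlow (hθz.differentiableAt one_ne_zero), formPullback,
      radialFlow, hθ.extDeriv_eq_zero _ (hθ.radialScaling_mem z hz t)]
    rfl
  · filter_upwards [(hθ.isOpen.prod isOpen_univ).mem_nhds ⟨hz, mem_univ t⟩]
      with ⟨z', t'⟩ hz' v ⟨i, hi⟩
    exact hθ.map_eq_zero _ (hθ.radialScaling_mem z' hz'.1 t') _
      ⟨i, (congrArg _ hi).trans (fderiv_radialFlow_time z' t')⟩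

theorem compContinuousLinearMap_radialScaling (hθ : IsClosedRadiallyHorizontalOn θ O) {z : X × Y}
    (hz : z ∈ O) (t : ℝ) :
    (θ (radialScaling X Y t z)).compContinuousLinearMap (radialScaling X Y t) = θ z := by
  ext w
  let f (s : ℝ) : ℝ := formPullback radialFlow θ (z, s) fun i => (w i, 0)
  have hf (s : ℝ) : HasDerivAt f 0 s := by
    have hpullback : DifferentiableAt ℝ (formPullback radialFlow θ) (z, s) :=
      (contDiffAt_formPullback_radialFlow
        (hθ.contDiffAt _ (hθ.radialScaling_mem z hz s))).differentiableAt one_ne_zero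
    have hslice : HasDerivAt (fun s : ℝ => formPullback radialFlow θ (z, s)) 0 s := by
      rw [← hθ.fderiv_formPullback_time hz s]
      exact hpullback.hasFDerivAt.comp_hasDerivAt s
        ((hasDerivAt_const s z).prodMk (hasDerivAt_id s))
    exact (ContinuousAlternatingMap.apply ℝ ((X × Y) × ℝ) ℝ
      fun i => (w i, 0)).hasFDerivAt.comp_hasDerivAt s hslice
  have hconst : f t = f 0 :=
    is_const_of_deriv_eq_zero (fun s => (hf s).differentiableAt) (fun s => (hf s).deriv) t 0
  simpa [f, formPullback, fderiv_radialFlow_space, radialFlow, radialScaling_apply,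
    Function.comp_def] using hconst

end IsClosedRadiallyHorizontalOn

theorem ContDiffInTubeAt.formPullback_radialFlow {k : ℕ}
    {α : X × Y → (X × Y) [⋀^Fin k]→L[ℝ] ℝ} {r : WithTop ℕ∞} {z : X × Y}
    (hα : ContDiffInTubeAt r α z.1) (hα0 : α =ᶠ[𝓝 (z.1, 0)] 0) (hz : z.2 ≠ 0) :
    ContDiffInTubeAt r (formPullback radialFlow α) z := by
  obtain ⟨C, hC, hαC⟩ := hα
  obtain ⟨u, hu, s, hs, hus⟩ := mem_nhds_prod_iff.1 hα0
  have hC0 : (0 : Y) ∉ C \ interior s := fun h => h.2 (mem_interior_iff_mem_nhds.2 hs)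
  obtain ⟨K, hK, hKC⟩ :=
    exists_isCompact_forall_exp_smul_notMem (hC.diff isOpen_interior) hC0 hz
  refine ⟨K, hK, ?_⟩
  filter_upwards [(hαC.and hu).prod_inl_nhds z.2, hKC.prod_inr_nhds z.1]
    with z' ⟨⟨hαsmooth, hαzero⟩, hzu⟩ hzK
  refine ⟨fun t => contDiffAt_formPullback_radialFlow (hαsmooth _), fun t ht => ?_⟩
  have hzero : α (radialScaling X Y t z') = 0 := by
    by_cases hts : Real.exp t • z'.2 ∈ s
    · exact hus (mk_mem_prod hzu hts)
    · exact hαzero _ fun htC => hzK t ht ⟨htC, fun h => hts (interior_subset h)⟩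
  rw [formPullback, radialFlow, hzero]
  rfl

end RadialFlow

section RayIntegral

open ContinuousAlternatingMap

variable {X Y : Type*} [NormedAddCommGroup X] [NormedSpace ℝ X] [NormedAddCommGroup Y]
  [NormedSpace ℝ Y] [FiniteDimensional ℝ X] [FiniteDimensional ℝ Y] {k : ℕ} {O : Set (X × Y)}
  {χ : X × Y → (X × Y) [⋀^Fin 1]→L[ℝ] ℝ} {θ : X × Y → (X × Y) [⋀^Fin k]→L[ℝ] ℝ}
  {α : X × Y → (X × Y) [⋀^Fin (k + 1)]→L[ℝ] ℝ} {z : X × Y}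

theorem prodFibreIntegral_formPullback_radialFlow (hθ : IsClosedRadiallyHorizontalOn θ O)
    (hχ : ∫ t : ℝ, χ (radialScaling X Y t z) (fun _ => (0, (radialScaling X Y t z).2)) = 1)
    (hα : ∀ z ∈ O, α z = wedgeOneForm (χ z) (θ z))
    (hint : Integrable fun t => formPullback radialFlow α (z, t)) (hz : z ∈ O) :
    prodFibreIntegral rfl (fun _ : Fin 1 => (1 : ℝ)) volume (formPullback radialFlow α) z =
      (-1 : ℝ) ^ k • θ z := by
  ext w
  have hintegrand (t : ℝ) : formPullback radialFlow α (z, t)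
      (appendArgs rfl (fun i => (w i, 0)) (fun _ : Fin 1 => (0, 1))) =
      (-1) ^ k * (χ (radialScaling X Y t z) (fun _ => (0, (radialScaling X Y t z).2)) * θ z w) := by
    have hzt := hθ.radialScaling_mem z hz t
    rw [appendArgs_const, formPullback_radialFlow_snoc, hα _ hzt,
      wedgeOneForm_snoc _ (hθ.map_eq_zero _ hzt), ← hθ.compContinuousLinearMap_radialScaling hz t]
    rfl
  rw [prodFibreIntegral_apply _ _ hint]
  simp only [hintegrand, integral_const_mul, integral_mul_const, hχ, one_mul]
  rfl

theorem integral_extDeriv_radialScaling_snoc_eq_zero (hθ : IsClosedRadiallyHorizontalOn θ O)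
    (hχ : ∀ z ∈ O,
      ∫ t : ℝ, χ (radialScaling X Y t z) (fun _ => (0, (radialScaling X Y t z).2)) = 1)
    (hα : ∀ z ∈ O, α z = wedgeOneForm (χ z) (θ z)) (hαz : ContDiffInTubeAt 1 α z.1)
    (hα0 : α =ᶠ[𝓝 (z.1, 0)] 0) (hz : z ∈ O) (w : Fin (k + 1) → X × Y) :
    ∫ t : ℝ, extDeriv α (radialScaling X Y t z)
      (Fin.snoc (radialScaling X Y t ∘ w) (0, (radialScaling X Y t z).2)) = 0 := by
  have htube := hαz.formPullback_radialFlow hα0 (snd_ne_zero_of_integral_eq_one (hχ z hz))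
  have hprimitive : prodFibreIntegral rfl (fun _ : Fin 1 => (1 : ℝ)) volume
      (formPullback radialFlow α) =ᶠ[𝓝 z] (-1 : ℝ) ^ k • θ := by
    filter_upwards [htube.eventually, hθ.isOpen.mem_nhds hz] with z' htube' hz'
    exact prodFibreIntegral_formPullback_radialFlow hθ (hχ z' hz') hα htube'.integrable hz'
  have hextDeriv (t : ℝ) : extDeriv (formPullback radialFlow α) (z, t) =
      formPullback radialFlow (extDeriv α) (z, t) :=
    extDeriv_formPullback_radialFlow (hαz.differentiableAt _)
  have hcommute := extDeriv_prodFibreIntegral (μ := volume) rfl rfl (fun _ : Fin 1 => (1 : ℝ)) htube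
  rw [hprimitive.extDeriv_eq, extDeriv_smul, hθ.extDeriv_eq_zero z hz, smul_zero] at hcommute
  have happly := DFunLike.congr_fun hcommute w
  rw [prodFibreIntegral_apply _ _ htube.integrable_extDeriv] at happly
  simp only [hextDeriv, appendArgs_const, formPullback_radialFlow_snoc] at happly
  exact happly.symm

theorem integral_compContinuousLinearMap_radialScaling_extDeriv_eq_zero
    (hd : Module.finrank ℝ (X × Y) = k + 1 + 1) (hθ : IsClosedRadiallyHorizontalOn θ O)
    (hχ : ∀ z ∈ O,
      ∫ t : ℝ, χ (radialScaling X Y t z) (fun _ => (0, (radialScaling X Y t z).2)) = 1)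
    (hα : ∀ z ∈ O, α z = wedgeOneForm (χ z) (θ z)) (hαz : ContDiffInTubeAt 1 α z.1)
    (hα0 : α =ᶠ[𝓝 (z.1, 0)] 0) (hz : z ∈ O) (v : Fin (k + 1 + 1) → X × Y) :
    ∫ t : ℝ, extDeriv α (radialScaling X Y t z) (radialScaling X Y t ∘ v) = 0 := by
  have hz0 := snd_ne_zero_of_integral_eq_one (hχ z hz)
  let β (t : ℝ) : (X × Y) [⋀^Fin (k + 1 + 1)]→L[ℝ] ℝ :=
    (extDeriv α (radialScaling X Y t z)).compContinuousLinearMap (radialScaling X Y t)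
  have hβ : β = fun t => (extDeriv (formPullback radialFlow α) (z, t)).compContinuousLinearMap
      (ContinuousLinearMap.inl ℝ (X × Y) ℝ) := by
    funext t
    rw [extDeriv_formPullback_radialFlow (hαz.differentiableAt _)]
    ext v
    simp [β, formPullback, radialFlow, fderiv_radialFlow_space, Function.comp_def]
  have hint : Integrable β := hβ ▸
    (compContinuousLinearMapCLM (ContinuousLinearMap.inl ℝ (X × Y) ℝ)).integrable_comp
      (hαz.formPullback_radialFlow hα0 hz0).integrable_extDeriv
  have happly (v : Fin (k + 1 + 1) → X × Y) : (∫ t, β t) v = ∫ t, β t v :=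
    ((ContinuousAlternatingMap.apply ℝ (X × Y) ℝ v).integral_comp_comm hint).symm
  have hzero : ∫ t, β t = 0 := by
    refine eq_zero_of_finrank_eq_of_map_eq_zero hd (R := ((0 : X), z.2)) (by simpa using hz0)
      fun v hv => map_eq_zero_of_forall_snoc _ (fun w => ?_) v hv
    rw [happly, ← integral_extDeriv_radialScaling_snoc_eq_zero hθ hχ hα hαz hα0 hz w]
    refine integral_congr_ae (Eventually.of_forall fun t => ?_)
    simp [β, Fin.comp_snoc, radialScaling_apply]
  exact (happly v).symm.trans (by rw [hzero]; rfl)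

variable {m n : ℕ} [MeasurableSpace Y] [BorelSpace Y] {μ : Measure Y} [μ.IsAddHaarMeasure]

theorem integral_extDeriv_appendArgs_eq_zero [Nontrivial Y] (hq : k + 1 + 1 = m + n)
    (hd : Module.finrank ℝ X = m) (b : Module.Basis (Fin n) ℝ Y)
    (hθ : IsClosedRadiallyHorizontalOn θ O)
    (hχ : ∀ z ∈ O,
      ∫ t : ℝ, χ (radialScaling X Y t z) (fun _ => (0, (radialScaling X Y t z).2)) = 1)
    (hα : ∀ z ∈ O, α z = wedgeOneForm (χ z) (θ z)) {x : X} (hαx : ContDiffInTubeAt 1 α x)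
    (hα0 : ∀ y, (x, y) ∉ O → α =ᶠ[𝓝 (x, y)] 0) (v : Fin m → X) :
    ∫ y, extDeriv α (x, y) (appendArgs hq (fun i => (v i, 0)) (fun i => (0, b i))) ∂μ = 0 := by
  have hdimY : Module.finrank ℝ Y = n := by simp [Module.finrank_eq_card_basis b]
  have hx : (x, 0) ∉ O := fun hx => snd_ne_zero_of_integral_eq_one (hχ _ hx) rfl
  refine integral_eq_zero_of_forall_integral_ray_eq_zero μ fun y _ => ?_
  by_cases hz : (x, y) ∈ O
  · simp only [hdimY, smul_eq_mul, exp_pow_mul_apply_appendArgs]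
    exact integral_compContinuousLinearMap_radialScaling_extDeriv_eq_zero
      (by rw [Module.finrank_prod, hd, hdimY, hq]) hθ hχ hα hαx (hα0 0 hx) hz _
  · refine integral_eq_zero_of_ae (Eventually.of_forall fun t => ?_)
    have hzt : (x, Real.exp t • y) ∉ O := fun h =>
      hz (by simpa using radialScaling_neg_radialScaling t (x, y) ▸ hθ.radialScaling_mem _ h (-t))
    have hzero : extDeriv α (x, Real.exp t • y) = 0 := by
      rw [extDeriv, (hasFDerivAt_zero_of_eventually_const 0 (hα0 _ hzt)).fderiv]
      exact map_zero (alternatizeUncurryFinCLM ℝ (X × Y) ℝ)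
    simp [hzero]

theorem extDeriv_prodFibreIntegral_eq_zero [Nontrivial Y] (hq : k + 1 = m + n)
    (hd : Module.finrank ℝ X = m + 1) (b : Module.Basis (Fin n) ℝ Y)
    (hθ : IsClosedRadiallyHorizontalOn θ O)
    (hχ : ∀ z ∈ O,
      ∫ t : ℝ, χ (radialScaling X Y t z) (fun _ => (0, (radialScaling X Y t z).2)) = 1)
    (hα : ∀ z ∈ O, α z = wedgeOneForm (χ z) (θ z)) {x : X} (hαx : ContDiffInTubeAt 1 α x)
    (hα0 : ∀ y, (x, y) ∉ O → α =ᶠ[𝓝 (x, y)] 0) :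
    extDeriv (prodFibreIntegral hq b μ α) x = 0 := by
  have hq' : k + 1 + 1 = m + 1 + n := by omega
  rw [extDeriv_prodFibreIntegral hq hq' b hαx]
  ext v
  rw [prodFibreIntegral_apply hq' b hαx.integrable_extDeriv]
  exact integral_extDeriv_appendArgs_eq_zero hq' hd b hθ hχ hα hαx hα0 v

end RayIntegral

/-! ### Supports which are proper over the base -/

section ProperSupport

variable {X Y F : Type*} [TopologicalSpace X] [TopologicalSpace Y] [Zero F] {O : Set (X × Y)}
  {f : X × Y → F} {x : X}

/-- Over a neighbourhood of `x`, the support of the function `f` on `X × Y` is contained in a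
compact subset of `O`: the support of `f` is proper over the base `X` near `x`. -/
def HasProperSupportNear (O : Set (X × Y)) (f : X × Y → F) (x : X) : Prop :=
  ∃ C ⊆ O, IsCompact C ∧ ∀ᶠ p in 𝓝 x, ∀ y, (p, y) ∉ C → f (p, y) = 0

theorem HasProperSupportNear.eventually (hf : HasProperSupportNear O f x) :
    ∀ᶠ p in 𝓝 x, HasProperSupportNear O f p :=
  let ⟨C, hCO, hC, hfC⟩ := hf
  hfC.eventually_nhds.mono fun _ hp => ⟨C, hCO, hC, hp⟩

theorem HasProperSupportNear.eventuallyEq_zero [T2Space X] [T2Space Y]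
    (hf : HasProperSupportNear O f x) {y : Y} (hy : (x, y) ∉ O) : f =ᶠ[𝓝 (x, y)] 0 := by
  obtain ⟨C, hCO, hC, hfC⟩ := hf
  filter_upwards [continuous_fst.continuousAt.eventually hfC,
    hC.isClosed.isOpen_compl.mem_nhds (mt (@hCO (x, y)) hy)] with z hz hzC using hz z.2 hzC

theorem isClosed_setOf_forall_notMem_imp_eq_zero [TopologicalSpace F] [T1Space F] [T2Space X]
    [T2Space Y] (hO : IsOpen O) (hf : ContinuousOn f O) (hf0 : ∀ z ∉ O, f z = 0)
    {C : Set (X × Y)} (hC : IsCompact C) :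
    IsClosed {x | ∀ y, (x, y) ∉ C → f (x, y) = 0} := by
  have hopen : IsOpen ((O ∩ f ⁻¹' {0}ᶜ) ∩ Cᶜ) :=
    (hf.isOpen_inter_preimage hO isOpen_compl_singleton).inter hC.isClosed.isOpen_compl
  have hcompl : {x | ∀ y, (x, y) ∉ C → f (x, y) = 0} =
      (Prod.fst '' ((O ∩ f ⁻¹' {0}ᶜ) ∩ Cᶜ))ᶜ := by
    ext x
    simp only [mem_ofPred_eq, mem_compl_iff, mem_image, Prod.exists, exists_and_right,
      exists_eq_right, not_exists, mem_inter_iff, mem_preimage, mem_singleton_iff]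
    exact forall_congr' fun y => ⟨fun h hy => hy.1.2 (h hy.2), fun h hy =>
      by_contra fun hne => h ⟨⟨by_contra fun hO => hne (hf0 _ hO), hne⟩, hy⟩⟩
  rw [hcompl]
  exact (isOpenMap_fst _ hopen).isClosed_compl

/-- The base is covered by the closed sets of those points over which the support is contained in
the `m`-th member of a compact exhaustion of `O`; by Baire's theorem the union of their interiors is
dense. -/
theorem dense_setOf_hasProperSupportNear [TopologicalSpace F] [T1Space F] [T2Space X] [T2Space Y]
    [LocallyCompactSpace X] [LocallyCompactSpace Y] [SecondCountableTopology X]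
    [SecondCountableTopology Y] (hO : IsOpen O) (hf : ContinuousOn f O) (hf0 : ∀ z ∉ O, f z = 0)
    (hK : ∀ x, ∃ K : Set Y, IsCompact K ∧ (∀ y ∈ K, (x, y) ∈ O) ∧ ∀ y ∉ K, f (x, y) = 0) :
    Dense {x | HasProperSupportNear O f x} := by
  have : LocallyCompactSpace O := hO.locallyCompactSpace
  let e : CompactExhaustion O := default
  let C (m : ℕ) : Set (X × Y) := Subtype.val '' e m
  have hC (m : ℕ) : IsCompact (C m) := (e.isCompact m).image continuous_subtype_val
  have hclosed (m : ℕ) : IsClosed {x | ∀ y, (x, y) ∉ C m → f (x, y) = 0} :=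
    isClosed_setOf_forall_notMem_imp_eq_zero hO hf hf0 (hC m)
  have hcover : ⋃ m, {x | ∀ y, (x, y) ∉ C m → f (x, y) = 0} = univ := by
    refine eq_univ_of_forall fun x => mem_iUnion.2 ?_
    obtain ⟨K, hK, hKO, hfK⟩ := hK x
    have hK' : IsCompact ((↑) ⁻¹' (Prod.mk x '' K) : Set O) :=
      (Topology.IsInducing.subtypeVal.isCompact_preimage_iff
        (by rintro _ ⟨y, hy, rfl⟩; simpa using hKO y hy)).2 (hK.image (by fun_prop))
    obtain ⟨m, hm⟩ := e.exists_superset_of_isCompact hK'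
    exact ⟨m, fun y hy => hfK y fun hyK => hy ⟨⟨(x, y), hKO y hyK⟩, hm ⟨y, hyK, rfl⟩, rfl⟩⟩
  refine (dense_iUnion_interior_of_closed hclosed hcover).mono (iUnion_subset fun m x hx => ?_)
  exact ⟨C m, Subtype.coe_image_subset O (e m), hC m, mem_interior_iff_mem_nhds.1 hx⟩

end ProperSupport

theorem HasProperSupportNear.contDiffInTubeAt {X Y F : Type*} [NormedAddCommGroup X]
    [NormedSpace ℝ X] [NormedAddCommGroup Y] [NormedSpace ℝ Y] [NormedAddCommGroup F]
    [NormedSpace ℝ F] {O : Set (X × Y)} {f : X × Y → F} {x : X} {r : WithTop ℕ∞}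
    (hf : HasProperSupportNear O f x) (hfO : ∀ z ∈ O, ContDiffAt ℝ r f z) :
    ContDiffInTubeAt r f x := by
  have hsmooth : ∀ᶠ p in 𝓝 x, ∀ y, ContDiffAt ℝ r f (p, y) := hf.eventually.mono fun p hp y => by
    by_cases hy : (p, y) ∈ O
    · exact hfO _ hy
    · exact contDiffAt_const.congr_of_eventuallyEq (hp.eventuallyEq_zero hy)
  obtain ⟨C, -, hC, hfC⟩ := hf
  refine ⟨Prod.snd '' C, hC.image continuous_snd, hsmooth.and (hfC.mono fun p hp y hy => ?_)⟩
  exact hp y fun hyC => hy ⟨_, hyC, rfl⟩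

/-! ### Differential forms in charts -/

section FormsInCharts

variable {E H N : Type*} [NormedAddCommGroup E] [NormedSpace ℝ E] [TopologicalSpace H]
  {I : ModelWithCorners ℝ E H} [TopologicalSpace N] [ChartedSpace H N]

theorem DiffForm.wedgeOne_inChart {k : ℕ} (χ : DiffForm I N 1) (θ : DiffForm I N k) (x : N)
    (y : E) : (χ.wedgeOne θ).inChart x y = wedgeOneForm (χ.inChart x y) (θ.inChart x y) :=
  wedgeOneForm_compContinuousLinearMap (V := E) (V' := E) (χ ((extChartAt I x).symm y))
    (θ ((extChartAt I x).symm y)) (mfderiv 𝓘(ℝ, E) I (extChartAt I x).symm y)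

theorem DiffForm.SmoothOn.wedgeOne [FiniteDimensional ℝ E] {k : ℕ} {χ : DiffForm I N 1}
    {θ : DiffForm I N k} {s : Set N} (hχ : χ.SmoothOn s) (hθ : θ.SmoothOn s) :
    (χ.wedgeOne θ).SmoothOn s := fun x hx => by
  simpa only [← χ.wedgeOne_inChart θ] using contDiffAt_wedgeOneForm (hχ x hx) (hθ x hx)

theorem DiffForm.inChart_eq_zero {k : ℕ} {α : DiffForm I N k} {x : N} {y : E}
    (h : α ((extChartAt I x).symm y) = 0) : α.inChart x y = 0 := by
  rw [DiffForm.inChart, h]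
  rfl

theorem DiffForm.d_eq_zero {k : ℕ} {α : DiffForm I N k} {x : N}
    (h : extDeriv (α.inChart x) (extChartAt I x x) = 0) : α.d x = 0 := by
  rw [DiffForm.d, h]
  rfl

variable [I.Boundaryless]

theorem mdifferentiableAt_extChartAt_symm [IsManifold I 1 N] {x : N} {y : E}
    (hy : y ∈ (extChartAt I x).target) : MDifferentiableAt 𝓘(ℝ, E) I (extChartAt I x).symm y := by
  have h := mdifferentiableWithinAt_extChartAt_symm (I := I) hy
  rwa [I.range_eq_univ, mdifferentiableWithinAt_univ] at h

theorem isInvertible_mfderiv_extChartAt_symm [IsManifold I 1 N] {x : N} {y : E}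
    (hy : y ∈ (extChartAt I x).target) :
    (mfderiv 𝓘(ℝ, E) I (extChartAt I x).symm y).IsInvertible := by
  have h := isInvertible_mfderivWithin_extChartAt_symm (I := I) hy
  rwa [I.range_eq_univ, mfderivWithin_univ] at h

theorem contDiffAt_extChartAt_comp_symm {r : WithTop ℕ∞} [IsManifold I r N] {x u : N} {y : E}
    (hy : y ∈ (extChartAt I x).target) (hu : (extChartAt I x).symm y ∈ (extChartAt I u).source) :
    ContDiffAt ℝ r (extChartAt I u ∘ (extChartAt I x).symm) y := by
  have h := contDiffWithinAt_ext_coord_change (I := I) (n := r) u x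
    (y := y) (by rw [PartialEquiv.trans_source]; exact ⟨hy, hu⟩)
  rwa [I.range_eq_univ, contDiffWithinAt_univ] at h

theorem mfderiv_extChartAt_symm_eq_comp [IsManifold I 1 N] {x u : N} {y : E}
    (hy : y ∈ (extChartAt I x).target) (hu : (extChartAt I x).symm y ∈ (extChartAt I u).source) :
    mfderiv 𝓘(ℝ, E) I (extChartAt I x).symm y =
      (mfderiv 𝓘(ℝ, E) I (extChartAt I u).symm (extChartAt I u ((extChartAt I x).symm y))).comp
        (fderiv ℝ (extChartAt I u ∘ (extChartAt I x).symm) y) := by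
  have hchange : MDifferentiableAt 𝓘(ℝ, E) 𝓘(ℝ, E) (extChartAt I u ∘ (extChartAt I x).symm) y :=
    (contDiffAt_extChartAt_comp_symm (r := 1) hy hu).differentiableAt one_ne_zero
      |>.mdifferentiableAt
  have hsymm : MDifferentiableAt 𝓘(ℝ, E) I (extChartAt I u).symm
      ((extChartAt I u ∘ (extChartAt I x).symm) y) :=
    mdifferentiableAt_extChartAt_symm ((extChartAt I u).map_source hu)
  have hfactor : (extChartAt I x).symm =ᶠ[𝓝 y]
      (extChartAt I u).symm ∘ (extChartAt I u ∘ (extChartAt I x).symm) := by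
    filter_upwards [(continuousAt_extChartAt_symm'' hy).preimage_mem_nhds
      ((isOpen_extChartAt_source u).mem_nhds hu)] with y' hy'
    exact ((extChartAt I u).left_inv hy').symm
  rw [hfactor.mfderiv_eq, mfderiv_comp y hsymm hchange, mfderiv_eq_fderiv]
  rfl

theorem DiffForm.inChart_eventuallyEq [IsManifold I 1 N] {k : ℕ} (α : DiffForm I N k) {x u : N}
    {y : E} (hy : y ∈ (extChartAt I x).target)
    (hu : (extChartAt I x).symm y ∈ (extChartAt I u).source) :
    α.inChart x =ᶠ[𝓝 y]
      formPullback (extChartAt I u ∘ (extChartAt I x).symm) (α.inChart u) := by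
  filter_upwards [(isOpen_extChartAt_target x).mem_nhds hy,
    (continuousAt_extChartAt_symm'' hy).preimage_mem_nhds
      ((isOpen_extChartAt_source u).mem_nhds hu)] with y' hy' hu'
  have hcongr (a b : N) (hab : a = b) (w : Fin k → E) :
      (α a : E [⋀^Fin k]→L[ℝ] ℝ) w = α b w := by subst hab; rfl
  ext v
  simp only [DiffForm.inChart, formPullback, ContinuousAlternatingMap.compContinuousLinearMap_apply]
  rw [mfderiv_extChartAt_symm_eq_comp hy' hu']
  exact hcongr _ _ ((extChartAt I u).left_inv hu').symm _

variable [IsManifold I ∞ N] {k : ℕ} {α : DiffForm I N k} {s : Set N} {x : N} {y : E}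

theorem DiffForm.SmoothOn.contDiffAt_inChart [FiniteDimensional ℝ E] (hα : α.SmoothOn s)
    (hy : y ∈ (extChartAt I x).target) (hs : (extChartAt I x).symm y ∈ s) :
    ContDiffAt ℝ ∞ (α.inChart x) y := by
  set u := (extChartAt I x).symm y
  have hu := mem_extChartAt_source (I := I) u
  have hα_u : ContDiffAt ℝ ∞ (α.inChart u) ((extChartAt I u ∘ (extChartAt I x).symm) y) := hα u hs
  exact (contDiffAt_formPullback hα_u (contDiffAt_extChartAt_comp_symm (r := ∞) hy hu)
    (by simp)).congr_of_eventuallyEq (α.inChart_eventuallyEq hy hu)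

theorem DiffForm.SmoothOn.extDeriv_inChart_eq_zero (hα : α.SmoothOn s)
    (hy : y ∈ (extChartAt I x).target) (hs : (extChartAt I x).symm y ∈ s)
    (hd : α.d ((extChartAt I x).symm y) = 0) : extDeriv (α.inChart x) y = 0 := by
  set u := (extChartAt I x).symm y with hu_def
  have hu := mem_extChartAt_source (I := I) u
  have hd_chart : extDeriv (α.inChart u) (extChartAt I u u) = 0 := by
    rw [DiffForm.d, mfderiv_extChartAt_self] at hd
    exact hd
  have hα_u : DifferentiableAt ℝ (α.inChart u) ((extChartAt I u ∘ (extChartAt I x).symm) y) :=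
    (hα u hs).differentiableAt (by simp)
  rw [(α.inChart_eventuallyEq hy hu).extDeriv_eq,
    extDeriv_formPullback hα_u (contDiffAt_extChartAt_comp_symm hy hu), formPullback,
    Function.comp_apply, ← hu_def, hd_chart]
  rfl

end FormsInCharts

/-! ### The charts of the tangent bundle -/

section TangentChart

variable {n : ℕ} {M : Type*} [TopologicalSpace M] [ChartedSpace (EuclideanSpace ℝ (Fin n)) M]
  [IsManifold (𝓡 n) ∞ M]

local notation "𝔼" => EuclideanSpace ℝ (Fin n)

variable (n) in
/-- The chart of `TM` over the preferred chart of `M` around `p`. The zero vector is only a choice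
of a base point: the chart of `TM` around `u` depends on `u.proj` alone. -/
abbrev tangentChart (p : M) : PartialEquiv (TangentBundle (𝓡 n) M) (𝔼 × 𝔼) :=
  extChartAt (𝓡 n).tangent (⟨p, (0 : 𝔼)⟩ : TangentBundle (𝓡 n) M)

variable (n) in
/-- The change of coordinates in `T_q M` from the preferred chart around `q`, which identifies
`T_q M` with the model space, to that around `p`. -/
abbrev fibreCoord (p q : M) : 𝔼 →L[ℝ] 𝔼 := tangentCoordChange (𝓡 n) q p q

variable {p q : M} {z : EuclideanSpace ℝ (Fin n) × EuclideanSpace ℝ (Fin n)}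

theorem tangentChart_symm_apply (p : M) (z : 𝔼 × 𝔼) :
    (tangentChart n p).symm z = fibreIncl ((extChartAt (𝓡 n) p).symm z.1)
      (tangentCoordChange (𝓡 n) p ((extChartAt (𝓡 n) p).symm z.1)
        ((extChartAt (𝓡 n) p).symm z.1) z.2) := rfl

theorem tangentChart_symm_smul (p : M) (x y : 𝔼) (c : ℝ) :
    (tangentChart n p).symm (x, c • y) = fibreIncl ((tangentChart n p).symm (x, y)).proj
      (c • ((tangentChart n p).symm (x, y)).2) := by
  simp only [tangentChart_symm_apply, map_smul]
  rfl

theorem mem_tangentChart_target :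
    z ∈ (tangentChart n p).target ↔ z.1 ∈ (extChartAt (𝓡 n) p).target := by
  rw [tangentChart, FiberBundle.extChartAt_target]
  simpa using fun h => (chartAt 𝔼 p).map_target h

theorem mem_tangentChart_source {u : TangentBundle (𝓡 n) M} :
    u ∈ (tangentChart n p).source ↔ u.proj ∈ (extChartAt (𝓡 n) p).source := by
  simp

theorem tangentCoordChange_fibreCoord (hq : q ∈ (extChartAt (𝓡 n) p).source) (y : 𝔼) :
    tangentCoordChange (𝓡 n) p q q (fibreCoord n p q y) = y := by
  rw [fibreCoord, tangentCoordChange_comp ⟨⟨mem_extChartAt_source q, hq⟩, mem_extChartAt_source q⟩,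
    tangentCoordChange_self (mem_extChartAt_source q)]

theorem tangentChart_symm_fibreCoord (hq : q ∈ (extChartAt (𝓡 n) p).source) (y : 𝔼) :
    (tangentChart n p).symm (extChartAt (𝓡 n) p q, fibreCoord n p q y) = fibreIncl q y :=
  (tangentChart n p).left_inv (mem_tangentChart_source.2 hq : fibreIncl q y ∈ _)

theorem fibreCoord_tangentChart_symm_snd (hz : z.1 ∈ (extChartAt (𝓡 n) p).target) :
    fibreCoord n p ((extChartAt (𝓡 n) p).symm z.1) ((tangentChart n p).symm z).2 = z.2 :=
  congrArg Prod.snd ((tangentChart n p).right_inv (mem_tangentChart_target.2 hz))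

theorem verticalLift_fibreIncl (hq : q ∈ (extChartAt (𝓡 n) p).source) (y e : 𝔼) :
    verticalLift (fibreIncl q y) e =
      mfderiv 𝓘(ℝ, 𝔼 × 𝔼) (𝓡 n).tangent (tangentChart n p).symm
        (extChartAt (𝓡 n) p q, fibreCoord n p q y) ((0 : 𝔼), fibreCoord n p q e) := by
  have hy : (extChartAt (𝓡 n) p q, fibreCoord n p q y) ∈ (tangentChart n p).target :=
    mem_tangentChart_target.2 ((extChartAt (𝓡 n) p).map_source hq)
  have hincl : fibreIncl (M := M) q = (tangentChart n p).symm ∘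
      fun y : 𝔼 => (extChartAt (𝓡 n) p q, fibreCoord n p q y) :=
    funext fun y => (tangentChart_symm_fibreCoord hq y).symm
  have hcoord : HasFDerivAt (fun y : 𝔼 => (extChartAt (𝓡 n) p q, fibreCoord n p q y))
      ((0 : 𝔼 →L[ℝ] 𝔼).prod (fibreCoord n p q)) y :=
    (hasFDerivAt_const _ _).prodMk (fibreCoord n p q).hasFDerivAt
  have hcomp := (mdifferentiableAt_extChartAt_symm hy).hasMFDerivAt.comp y hcoord.hasMFDerivAt
  change mfderiv 𝓘(ℝ, 𝔼) (𝓡 n).tangent (fibreIncl (M := M) q) y e = _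
  rw [hincl, hcomp.mfderiv]
  rfl

theorem mfderiv_tangentChart_symm_vertical (hz : z.1 ∈ (extChartAt (𝓡 n) p).target) (e : 𝔼) :
    mfderiv 𝓘(ℝ, 𝔼 × 𝔼) (𝓡 n).tangent (tangentChart n p).symm z ((0 : 𝔼), e) =
      verticalLift ((tangentChart n p).symm z) ((tangentChart n p).symm (z.1, e)).2 := by
  have hq := (extChartAt (𝓡 n) p).map_target hz
  have hcoord (y : 𝔼) : fibreCoord n p ((extChartAt (𝓡 n) p).symm z.1)
      ((tangentChart n p).symm (z.1, y)).2 = y :=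
    fibreCoord_tangentChart_symm_snd (z := (z.1, y)) hz
  have hlift := verticalLift_fibreIncl hq ((tangentChart n p).symm (z.1, z.2)).2
    ((tangentChart n p).symm (z.1, e)).2
  rw [hcoord, hcoord, (extChartAt (𝓡 n) p).right_inv hz] at hlift
  exact hlift.symm

theorem mfderiv_tangentChart_symm_radial (hz : z.1 ∈ (extChartAt (𝓡 n) p).target) :
    mfderiv 𝓘(ℝ, 𝔼 × 𝔼) (𝓡 n).tangent (tangentChart n p).symm z ((0 : 𝔼), z.2) =
      radialField ((tangentChart n p).symm z) :=
  mfderiv_tangentChart_symm_vertical hz z.2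

theorem mfderiv_proj_mfderiv_tangentChart_symm (hz : z.1 ∈ (extChartAt (𝓡 n) p).target)
    (v : 𝔼 × 𝔼) :
    mfderiv (𝓡 n).tangent (𝓡 n) (fun w : TangentBundle (𝓡 n) M => w.proj)
      ((tangentChart n p).symm z)
      (mfderiv 𝓘(ℝ, 𝔼 × 𝔼) (𝓡 n).tangent (tangentChart n p).symm z v) =
    mfderiv 𝓘(ℝ, 𝔼) (𝓡 n) (extChartAt (𝓡 n) p).symm z.1 v.1 := by
  have hproj : MDifferentiableAt (𝓡 n).tangent (𝓡 n) (fun w : TangentBundle (𝓡 n) M => w.proj)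
      ((tangentChart n p).symm z) :=
    (contMDiffAt_proj (n := 1) (TangentSpace (𝓡 n))).mdifferentiableAt one_ne_zero
  have hproj_symm := hproj.hasMFDerivAt.comp z
    (mdifferentiableAt_extChartAt_symm (mem_tangentChart_target.2 hz)).hasMFDerivAt
  have hfst : HasFDerivAt (Prod.fst : 𝔼 × 𝔼 → 𝔼) (ContinuousLinearMap.fst ℝ 𝔼 𝔼) z :=
    hasFDerivAt_fst
  have hsymm_fst :=
    (mdifferentiableAt_extChartAt_symm (I := 𝓡 n) hz).hasMFDerivAt.comp z hfst.hasMFDerivAt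
  exact DFunLike.congr_fun (hasMFDerivAt_unique hproj_symm hsymm_fst) v

theorem exists_eq_mfderiv_tangentChart_symm (hz : z.1 ∈ (extChartAt (𝓡 n) p).target)
    (ξ : TangentSpace (𝓡 n).tangent ((tangentChart n p).symm z)) (v : 𝔼)
    (hξ : mfderiv (𝓡 n).tangent (𝓡 n) (fun w : TangentBundle (𝓡 n) M => w.proj)
      ((tangentChart n p).symm z) ξ = mfderiv 𝓘(ℝ, 𝔼) (𝓡 n) (extChartAt (𝓡 n) p).symm z.1 v) :
    ∃ c : 𝔼, ξ = mfderiv 𝓘(ℝ, 𝔼 × 𝔼) (𝓡 n).tangent (tangentChart n p).symm z (v, c) := by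
  obtain ⟨⟨v', c⟩, rfl⟩ := (isInvertible_mfderiv_extChartAt_symm (I := (𝓡 n).tangent)
    (mem_tangentChart_target.2 hz)).bijective.2 ξ
  have hv : v' = v := (isInvertible_mfderiv_extChartAt_symm (I := 𝓡 n) hz).injective
    ((mfderiv_proj_mfderiv_tangentChart_symm hz (v', c)).symm.trans hξ)
  exact ⟨c, by rw [hv]⟩

end TangentChart

/-! ### The radial vector field -/

section RadialField

variable {n : ℕ} {M : Type*} [TopologicalSpace M] [ChartedSpace (EuclideanSpace ℝ (Fin n)) M]
  [IsManifold (𝓡 n) ∞ M]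

local notation "𝔼" => EuclideanSpace ℝ (Fin n)

theorem mfderiv_extChartAt_radialField {u u' : TangentBundle (𝓡 n) M}
    (hu' : u' ∈ (extChartAt (𝓡 n).tangent u).source) :
    mfderiv (𝓡 n).tangent 𝓘(ℝ, 𝔼 × 𝔼) (extChartAt (𝓡 n).tangent u) u' (radialField u') =
      ((0 : 𝔼), (tangentChart n u.proj u').2) := by
  have htarget := (tangentChart n u.proj).map_source hu'
  have hradial := mfderiv_tangentChart_symm_radial (mem_tangentChart_target.1 htarget)
  have hinverse := mfderiv_extChartAt_comp_mfderivWithin_extChartAt_symm (I := (𝓡 n).tangent)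
    (x := u) htarget
  rw [(𝓡 n).tangent.range_eq_univ, mfderivWithin_univ] at hinverse
  have happly := DFunLike.congr_fun hinverse ((0 : 𝔼), (tangentChart n u.proj u').2)
  change mfderiv (𝓡 n).tangent 𝓘(ℝ, 𝔼 × 𝔼) (extChartAt (𝓡 n).tangent u)
    ((tangentChart n u.proj).symm (tangentChart n u.proj u'))
    (mfderiv 𝓘(ℝ, 𝔼 × 𝔼) (𝓡 n).tangent (tangentChart n u.proj).symm (tangentChart n u.proj u')
      ((0 : 𝔼), (tangentChart n u.proj u').2)) = _ at happly
  rw [hradial, (tangentChart n u.proj).left_inv hu'] at happly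
  exact happly

theorem smoothVectorFieldOn_radialField (U : Set (TangentBundle (𝓡 n) M)) :
    SmoothVectorFieldOn (𝓡 n).tangent (radialField (n := n) (M := M)) U := by
  intro u _
  refine ContMDiffAt.contMDiffWithinAt ?_
  rw [contMDiffAt_section]
  have hchart : ContMDiffAt (𝓡 n).tangent 𝓘(ℝ, 𝔼 × 𝔼) ∞ (tangentChart n u.proj) u :=
    contMDiffAt_extChartAt (I := (𝓡 n).tangent) (x := u)
  have hvertical : ContDiff ℝ ∞ (fun z : 𝔼 × 𝔼 => ((0 : 𝔼), z.2)) :=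
    contDiff_const.prodMk contDiff_snd
  refine (hvertical.contMDiff.contMDiffAt.comp u hchart).congr_of_eventuallyEq ?_
  filter_upwards [(isOpen_extChartAt_source (I := (𝓡 n).tangent) u).mem_nhds
    (mem_extChartAt_source u)] with u' hu'
  have hu'_source : u' ∈ (chartAt (ModelProd 𝔼 𝔼) u).source := by rwa [extChartAt_source] at hu'
  have htrivialization : (trivializationAt (𝔼 × 𝔼) (TangentSpace (𝓡 n).tangent) u
      (⟨u', radialField u'⟩ : TotalSpace (𝔼 × 𝔼) (TangentSpace (𝓡 n).tangent))).2 =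
      (trivializationAt (𝔼 × 𝔼) (TangentSpace (𝓡 n).tangent) u).continuousLinearMapAt ℝ u'
        (radialField u') := by
    rw [Trivialization.continuousLinearMapAt_apply, Trivialization.linearMapAt_apply, if_pos]
    exact hu'_source
  rw [TangentBundle.continuousLinearMapAt_trivializationAt hu'_source] at htrivialization
  exact htrivialization.trans (mfderiv_extChartAt_radialField hu')

end RadialField

/-! ### Conic sets and the transport equations in a chart -/

section ConicChart

variable {n : ℕ} {M : Type*} [TopologicalSpace M] [ChartedSpace (EuclideanSpace ℝ (Fin n)) M]
  [IsManifold (𝓡 n) ∞ M]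

local notation "𝔼" => EuclideanSpace ℝ (Fin n)

/-- The set `U ⊆ TM` in the chart of `TM` over the preferred chart around `p`. -/
def chartPreimage (p : M) (U : Set (TangentBundle (𝓡 n) M)) : Set (𝔼 × 𝔼) :=
  (tangentChart n p).target ∩ (tangentChart n p).symm ⁻¹' U

variable {U : Set (TangentBundle (𝓡 n) M)} {p q : M}
  {z : EuclideanSpace ℝ (Fin n) × EuclideanSpace ℝ (Fin n)}

theorem isOpen_chartPreimage (hU : IsOpen U) : IsOpen (chartPreimage p U) :=
  (continuousOn_extChartAt_symm _).isOpen_inter_preimage (isOpen_extChartAt_target _) hU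

theorem fst_mem_target_of_mem_chartPreimage (hz : z ∈ chartPreimage p U) :
    z.1 ∈ (extChartAt (𝓡 n) p).target := mem_tangentChart_target.1 hz.1

theorem mem_chartPreimage_iff (hq : q ∈ (extChartAt (𝓡 n) p).source) (y : 𝔼) :
    (extChartAt (𝓡 n) p q, fibreCoord n p q y) ∈ chartPreimage p U ↔ fibreIncl q y ∈ U := by
  rw [chartPreimage, mem_inter_iff, mem_preimage, tangentChart_symm_fibreCoord hq]
  exact and_iff_right (mem_tangentChart_target.2 ((extChartAt (𝓡 n) p).map_source hq))

theorem tangentChart_symm_radialScaling (p : M) (t : ℝ) (z : 𝔼 × 𝔼) :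
    (tangentChart n p).symm (radialScaling 𝔼 𝔼 t z) =
      fibreIncl ((tangentChart n p).symm z).proj (Real.exp t • ((tangentChart n p).symm z).2) :=
  tangentChart_symm_smul p z.1 z.2 (Real.exp t)

theorem radialScaling_mem_chartPreimage
    (hU : ∀ u ∈ U, ∀ c : ℝ, 0 < c → (⟨u.proj, c • u.2⟩ : TangentBundle (𝓡 n) M) ∈ U)
    (hz : z ∈ chartPreimage p U) (t : ℝ) : radialScaling 𝔼 𝔼 t z ∈ chartPreimage p U := by
  have hfst := fst_mem_target_of_mem_chartPreimage hz
  refine ⟨mem_tangentChart_target.2 hfst, ?_⟩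
  rw [mem_preimage, tangentChart_symm_radialScaling]
  exact hU _ hz.2 _ (Real.exp_pos t)

theorem DiffForm.ContractionVanishesOn.inChart_apply_eq_zero {k : ℕ}
    {θ : DiffForm (𝓡 n).tangent (TangentBundle (𝓡 n) M) k}
    (hθ : θ.ContractionVanishesOn radialField U) (hz : z ∈ chartPreimage p U)
    {v : Fin k → 𝔼 × 𝔼} (hv : ∃ i, v i = ((0 : 𝔼), z.2)) :
    θ.inChart (⟨p, (0 : 𝔼)⟩ : TangentBundle (𝓡 n) M) z v = 0 := by
  obtain ⟨i, hi⟩ := hv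
  refine hθ _ hz.2 _ ⟨i, ?_⟩
  rw [← mfderiv_tangentChart_symm_radial (fst_mem_target_of_mem_chartPreimage hz), ← hi]
  rfl

theorem isClosedRadiallyHorizontalOn_chartPreimage {k : ℕ}
    {θ : DiffForm (𝓡 n).tangent (TangentBundle (𝓡 n) M) k} (hU : IsOpen U)
    (hUc : ∀ u ∈ U, ∀ c : ℝ, 0 < c → (⟨u.proj, c • u.2⟩ : TangentBundle (𝓡 n) M) ∈ U)
    (hθ : θ.SmoothOn U) (hθd : ∀ u ∈ U, θ.d u = 0) (hθr : θ.ContractionVanishesOn radialField U)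
    (p : M) : IsClosedRadiallyHorizontalOn
      (θ.inChart (⟨p, (0 : 𝔼)⟩ : TangentBundle (𝓡 n) M)) (chartPreimage p U) where
  isOpen := isOpen_chartPreimage hU
  radialScaling_mem _ hz t := radialScaling_mem_chartPreimage hUc hz t
  contDiffAt _ hz := (hθ.contDiffAt_inChart hz.1 hz.2).of_le (by simp)
  extDeriv_eq_zero _ hz := hθ.extDeriv_inChart_eq_zero hz.1 hz.2 (hθd _ hz.2)
  map_eq_zero _ hz _ hv := hθr.inChart_apply_eq_zero hz hv

theorem inChart_radialScaling_eq_smul_rayCoefficient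
    (χ : DiffForm (𝓡 n).tangent (TangentBundle (𝓡 n) M) 1)
    (hz : z.1 ∈ (extChartAt (𝓡 n) p).target) (t : ℝ) :
    χ.inChart (⟨p, (0 : 𝔼)⟩ : TangentBundle (𝓡 n) M) (radialScaling 𝔼 𝔼 t z)
      (fun _ => ((0 : 𝔼), (radialScaling 𝔼 𝔼 t z).2)) =
      Real.exp t • rayCoefficient χ ((tangentChart n p).symm z) (Real.exp t) := by
  have hlift := mfderiv_tangentChart_symm_vertical (z := radialScaling 𝔼 𝔼 t z) hz z.2
  have hscale : (fun _ : Fin 1 => ((0 : 𝔼), (radialScaling 𝔼 𝔼 t z).2)) =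
      fun _ => Real.exp t • ((0 : 𝔼), z.2) := by
    simp only [radialScaling_apply, Prod.smul_mk, smul_zero]
  have hcongr (u u' : TangentBundle (𝓡 n) M) (huu' : u = u') (e : 𝔼) :
      χ u (fun _ => verticalLift u e) = χ u' (fun _ => verticalLift u' e) := by subst huu'; rfl
  have hlinear (β : (𝔼 × 𝔼) [⋀^Fin 1]→L[ℝ] ℝ) (c : ℝ) (v : 𝔼 × 𝔼) :
      β (fun _ => c • v) = c • β fun _ => v :=
    (β.toMultilinearMap.map_smul_univ (fun _ => c) fun _ => v).trans (by simp)
  rw [hscale, hlinear]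
  congr 1
  refine (congrArg (χ _) (funext fun _ => hlift)).trans ?_
  exact hcongr _ _ (tangentChart_symm_radialScaling p t z) _

theorem integral_inChart_radialScaling (χ : DiffForm (𝓡 n).tangent (TangentBundle (𝓡 n) M) 1)
    (hz : z.1 ∈ (extChartAt (𝓡 n) p).target) :
    ∫ t : ℝ, χ.inChart (⟨p, (0 : 𝔼)⟩ : TangentBundle (𝓡 n) M) (radialScaling 𝔼 𝔼 t z)
        (fun _ => ((0 : 𝔼), (radialScaling 𝔼 𝔼 t z).2)) =
      ∫ c in Ioi (0 : ℝ), rayCoefficient χ ((tangentChart n p).symm z) c := by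
  simp only [inChart_radialScaling_eq_smul_rayCoefficient χ hz, integral_Ioi_zero_eq_integral_exp]

end ConicChart

/-! ### The fibre integral in a chart -/

section FibreIntegralInChart

theorem integral_comp_eq_abs_det_inv_smul {F : Type*} [NormedAddCommGroup F] [NormedSpace ℝ F]
    {G : Type*} [NormedAddCommGroup G] [NormedSpace ℝ G] [FiniteDimensional ℝ G]
    [MeasurableSpace G] [BorelSpace G] (μ : Measure G) [μ.IsAddHaarMeasure] {T : G →L[ℝ] G}
    (hT : LinearMap.det (T : G →ₗ[ℝ] G) ≠ 0) (f : G → F) :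
    ∫ y, f (T y) ∂μ = |LinearMap.det (T : G →ₗ[ℝ] G)|⁻¹ • ∫ y, f y ∂μ := by
  let e : G ≃ₜ G := ((T : G →ₗ[ℝ] G).equivOfDetNeZero hT).toContinuousLinearEquiv.toHomeomorph
  have hmap : Measure.map e μ = ENNReal.ofReal |(LinearMap.det (T : G →ₗ[ℝ] G))⁻¹| • μ :=
    Measure.map_linearMap_addHaar_eq_smul_addHaar μ hT
  have hchange := e.measurableEmbedding.integral_map (μ := μ) f
  rw [hmap, integral_smul_measure, ENNReal.toReal_ofReal (abs_nonneg _), abs_inv] at hchange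
  exact hchange.symm

theorem integral_compContinuousLinearMap {X V V' : Type*} [MeasurableSpace X] {μ : Measure X}
    [NormedAddCommGroup V] [NormedSpace ℝ V] [NormedAddCommGroup V'] [NormedSpace ℝ V'] {k : ℕ}
    {D : V' →L[ℝ] V} (hD : D.IsInvertible) (f : X → V [⋀^Fin k]→L[ℝ] ℝ) :
    (∫ y, f y ∂μ).compContinuousLinearMap D = ∫ y, (f y).compContinuousLinearMap D ∂μ := by
  obtain ⟨e, rfl⟩ := hD
  exact (e.symm.continuousAlternatingMapCongrLeft.integral_comp_comm f).symm

variable {n : ℕ} {M : Type*} [TopologicalSpace M] [ChartedSpace (EuclideanSpace ℝ (Fin n)) M]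
  [IsManifold (𝓡 n) ∞ M]

local notation "𝔼" => EuclideanSpace ℝ (Fin n)

/-- The expression of a form on `U ⊆ TM` in the chart of `TM` over the preferred chart around `p`,
extended by zero outside `U`. -/
def DiffForm.inTangentChart {k : ℕ} (α : DiffForm (𝓡 n).tangent (TangentBundle (𝓡 n) M) k)
    (p : M) (U : Set (TangentBundle (𝓡 n) M)) : 𝔼 × 𝔼 → (𝔼 × 𝔼) [⋀^Fin k]→L[ℝ] ℝ :=
  (chartPreimage p U).indicator (α.inChart (⟨p, (0 : 𝔼)⟩ : TangentBundle (𝓡 n) M))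

variable {U : Set (TangentBundle (𝓡 n) M)} {p q : M} {k m : ℕ}
  {z : EuclideanSpace ℝ (Fin n) × EuclideanSpace ℝ (Fin n)}

theorem DiffForm.inTangentChart_of_mem
    (α : DiffForm (𝓡 n).tangent (TangentBundle (𝓡 n) M) k) (hz : z ∈ chartPreimage p U) :
    α.inTangentChart p U z = α.inChart (⟨p, (0 : 𝔼)⟩ : TangentBundle (𝓡 n) M) z :=
  indicator_of_mem hz _

theorem DiffForm.inTangentChart_of_notMem
    (α : DiffForm (𝓡 n).tangent (TangentBundle (𝓡 n) M) k) (hz : z ∉ chartPreimage p U) :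
    α.inTangentChart p U z = 0 :=
  indicator_of_notMem hz _

theorem DiffForm.inTangentChart_eventuallyEq
    (α : DiffForm (𝓡 n).tangent (TangentBundle (𝓡 n) M) k) (hU : IsOpen U)
    (hz : z ∈ chartPreimage p U) :
    α.inTangentChart p U =ᶠ[𝓝 z] α.inChart (⟨p, (0 : 𝔼)⟩ : TangentBundle (𝓡 n) M) :=
  eventuallyEq_of_mem ((isOpen_chartPreimage hU).mem_nhds hz) fun _ => α.inTangentChart_of_mem

theorem DiffForm.inTangentChart_eq_zero {α : DiffForm (𝓡 n).tangent (TangentBundle (𝓡 n) M) k}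
    (h : (tangentChart n p).symm z ∈ U → α ((tangentChart n p).symm z) = 0) :
    α.inTangentChart p U z = 0 := by
  by_cases hz : z ∈ chartPreimage p U
  · rw [α.inTangentChart_of_mem hz, DiffForm.inChart_eq_zero (h hz.2)]
  · exact α.inTangentChart_of_notMem hz

theorem DiffForm.SmoothOn.contDiffAt_inTangentChart
    {α : DiffForm (𝓡 n).tangent (TangentBundle (𝓡 n) M) k} (hα : α.SmoothOn U) (hU : IsOpen U)
    (hz : z ∈ chartPreimage p U) : ContDiffAt ℝ ∞ (α.inTangentChart p U) z :=
  (hα.contDiffAt_inChart hz.1 hz.2).congr_of_eventuallyEq (α.inTangentChart_eventuallyEq hU hz)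

theorem det_fibreCoord_ne_zero (hq : q ∈ (extChartAt (𝓡 n) p).source) :
    LinearMap.det (fibreCoord n p q : 𝔼 →ₗ[ℝ] 𝔼) ≠ 0 := by
  have hinverse : (tangentCoordChange (𝓡 n) p q q : 𝔼 →ₗ[ℝ] 𝔼) ∘ₗ
      (fibreCoord n p q : 𝔼 →ₗ[ℝ] 𝔼) = LinearMap.id :=
    LinearMap.ext fun e => tangentCoordChange_fibreCoord hq e
  have hdet := congrArg LinearMap.det hinverse
  rw [LinearMap.det_comp, LinearMap.det_id] at hdet
  exact right_ne_zero_of_mul_eq_one hdet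

theorem verticalLift_mem_span (u : TangentBundle (𝓡 n) M) (e : 𝔼) :
    verticalLift u e ∈ Submodule.span ℝ
      (range fun i => verticalLift u (EuclideanSpace.basisFun (Fin n) ℝ i)) := by
  let lift : 𝔼 →L[ℝ] 𝔼 × 𝔼 :=
    mfderiv 𝓘(ℝ, 𝔼) (𝓡 n).tangent (fibreIncl (M := M) u.proj) u.2
  have he := (EuclideanSpace.basisFun (Fin n) ℝ).toBasis.mem_span e
  rw [OrthonormalBasis.coe_toBasis] at he
  have hlift := Submodule.apply_mem_span_image_of_mem_span (lift : 𝔼 →ₗ[ℝ] 𝔼 × 𝔼) he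
  rw [← range_comp] at hlift
  exact hlift

theorem sectionLift_sub_mem_span (hz : z.1 ∈ (extChartAt (𝓡 n) p).target) (v : 𝔼) :
    (sectionLift ((tangentChart n p).symm z)
        (mfderiv 𝓘(ℝ, 𝔼) (𝓡 n) (extChartAt (𝓡 n) p).symm z.1 v) -
      mfderiv 𝓘(ℝ, 𝔼 × 𝔼) (𝓡 n).tangent (tangentChart n p).symm z (v, (0 : 𝔼)) : 𝔼 × 𝔼) ∈
    Submodule.span ℝ (range fun i => (verticalLift ((tangentChart n p).symm z)
      (EuclideanSpace.basisFun (Fin n) ℝ i) : 𝔼 × 𝔼)) := by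
  obtain ⟨c, hc⟩ := exists_eq_mfderiv_tangentChart_symm hz _ v
    (mfderiv_proj_sectionLift ((tangentChart n p).symm z) _)
  let D : 𝔼 × 𝔼 →L[ℝ] 𝔼 × 𝔼 := mfderiv 𝓘(ℝ, 𝔼 × 𝔼) (𝓡 n).tangent (tangentChart n p).symm z
  have hdiff : D (v, c) - D (v, 0) = D (0, c) := by
    rw [← map_sub, Prod.mk_sub_mk, sub_self, sub_zero]
  have hvertical := verticalLift_mem_span ((tangentChart n p).symm z)
    ((tangentChart n p).symm (z.1, c)).2
  rw [← mfderiv_tangentChart_symm_vertical hz] at hvertical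
  rw [hc]
  exact hdiff ▸ hvertical

theorem contractLast_compContinuousLinearMap_mfderiv_symm (hq : m = k + n)
    (α : DiffForm (𝓡 n).tangent (TangentBundle (𝓡 n) M) m)
    (hz : z.1 ∈ (extChartAt (𝓡 n) p).target) :
    (contractLast hq (E := 𝔼) (α ((tangentChart n p).symm z))
      (sectionLift ((tangentChart n p).symm z))
      (fun i => verticalLift ((tangentChart n p).symm z)
        (EuclideanSpace.basisFun (Fin n) ℝ i))).compContinuousLinearMap
      (mfderiv 𝓘(ℝ, 𝔼) (𝓡 n) (extChartAt (𝓡 n) p).symm z.1) =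
    LinearMap.det (fibreCoord n p ((extChartAt (𝓡 n) p).symm z.1) : 𝔼 →ₗ[ℝ] 𝔼) •
      contractLast hq (α.inChart (⟨p, (0 : 𝔼)⟩ : TangentBundle (𝓡 n) M) z)
        (ContinuousLinearMap.inl ℝ 𝔼 𝔼)
        (fun i => ((0 : 𝔼), (EuclideanSpace.basisFun (Fin n) ℝ).toBasis i)) := by
  set u := (tangentChart n p).symm z
  let T : 𝔼 →L[ℝ] 𝔼 := fibreCoord n p ((extChartAt (𝓡 n) p).symm z.1)
  let D₀ : 𝔼 →L[ℝ] 𝔼 := mfderiv 𝓘(ℝ, 𝔼) (𝓡 n) (extChartAt (𝓡 n) p).symm z.1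
  let D : 𝔼 × 𝔼 →L[ℝ] 𝔼 × 𝔼 := mfderiv 𝓘(ℝ, 𝔼 × 𝔼) (𝓡 n).tangent (tangentChart n p).symm z
  let lift : 𝔼 →L[ℝ] 𝔼 × 𝔼 := sectionLift u
  let A : (𝔼 × 𝔼) [⋀^Fin m]→L[ℝ] ℝ := α u
  let vertical : Fin n → 𝔼 × 𝔼 := fun i => verticalLift u (EuclideanSpace.basisFun (Fin n) ℝ i)
  have hvertical : vertical = fun i => ((D : 𝔼 × 𝔼 →ₗ[ℝ] 𝔼 × 𝔼) ∘ₗ LinearMap.inr ℝ 𝔼 𝔼)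
      ((T : 𝔼 →ₗ[ℝ] 𝔼) ((EuclideanSpace.basisFun (Fin n) ℝ).toBasis i)) := by
    funext i
    rw [OrthonormalBasis.coe_toBasis]
    have hlift := mfderiv_tangentChart_symm_vertical hz (T (EuclideanSpace.basisFun (Fin n) ℝ i))
    have hinverse := tangentCoordChange_fibreCoord ((extChartAt (𝓡 n) p).map_target hz)
      (EuclideanSpace.basisFun (Fin n) ℝ i)
    exact (hlift.trans (congrArg (verticalLift u) hinverse)).symm
  calc contractLast hq A (lift ∘L D₀) vertical
      = contractLast hq A (D ∘L ContinuousLinearMap.inl ℝ 𝔼 𝔼) vertical :=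
        contractLast_congr_of_sub_mem_span hq A (sectionLift_sub_mem_span hz)
    _ = LinearMap.det (T : 𝔼 →ₗ[ℝ] 𝔼) • contractLast hq A (D ∘L ContinuousLinearMap.inl ℝ 𝔼 𝔼)
          (fun i => D (0, (EuclideanSpace.basisFun (Fin n) ℝ).toBasis i)) := by
        rw [hvertical, contractLast_det]
        rfl
    _ = _ := by
        rw [← contractLast_compContinuousLinearMap]
        rfl

theorem isOpen_setOf_fibreIncl_mem (hU : IsOpen U) (q : M) : IsOpen {y : 𝔼 | fibreIncl q y ∈ U} :=
  hU.preimage (FiberBundle.continuous_totalSpaceMk 𝔼 (TangentSpace (𝓡 n)) q)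

theorem indicator_contractLast_compContinuousLinearMap (hm : m = k + n)
    (α : DiffForm (𝓡 n).tangent (TangentBundle (𝓡 n) M) m)
    (hq : q ∈ (extChartAt (𝓡 n) p).source) (y : 𝔼) :
    ({y : 𝔼 | fibreIncl q y ∈ U}.indicator (fun y => (contractLast hm (E := 𝔼)
      (α (fibreIncl q y)) (sectionLift (fibreIncl q y)) (fun i => verticalLift (fibreIncl q y)
        (EuclideanSpace.basisFun (Fin n) ℝ i))).compContinuousLinearMap
          (mfderiv 𝓘(ℝ, 𝔼) (𝓡 n) (extChartAt (𝓡 n) p).symm (extChartAt (𝓡 n) p q))) y :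
        𝔼 [⋀^Fin k]→L[ℝ] ℝ) =
    LinearMap.det (fibreCoord n p q : 𝔼 →ₗ[ℝ] 𝔼) •
      contractLast hm (α.inTangentChart p U (extChartAt (𝓡 n) p q, fibreCoord n p q y))
        (ContinuousLinearMap.inl ℝ 𝔼 𝔼)
        (fun i => ((0 : 𝔼), (EuclideanSpace.basisFun (Fin n) ℝ).toBasis i)) := by
  by_cases hy : fibreIncl q y ∈ U
  · have hchart := contractLast_compContinuousLinearMap_mfderiv_symm hm α
      (z := (extChartAt (𝓡 n) p q, fibreCoord n p q y)) ((extChartAt (𝓡 n) p).map_source hq)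
    rw [tangentChart_symm_fibreCoord hq, (extChartAt (𝓡 n) p).left_inv hq,
      ← α.inTangentChart_of_mem ((mem_chartPreimage_iff hq y).2 hy)] at hchart
    exact (indicator_of_mem (s := {y : 𝔼 | fibreIncl q y ∈ U}) hy _).trans hchart
  · rw [α.inTangentChart_of_notMem (mt (mem_chartPreimage_iff hq y).1 hy)]
    exact (indicator_of_notMem (s := {y : 𝔼 | fibreIncl q y ∈ U}) hy _).trans (smul_zero _).symm

/-- The sign, with respect to the orientation of `T_q M`, of the coordinates given by the preferred
chart around `p`: `o.sign q` is the sign for the preferred chart around `q` itself. -/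
def ManifoldOrientation.chartSign (o : ManifoldOrientation n M) (p q : M) : ℝ :=
  o.sign q * SignType.sign (LinearMap.det (fibreCoord n p q : 𝔼 →ₗ[ℝ] 𝔼))

theorem fibreIntegral_inChart (o : ManifoldOrientation n M) (hU : IsOpen U) (hm : m = k + n)
    (α : DiffForm (𝓡 n).tangent (TangentBundle (𝓡 n) M) m)
    (hq : q ∈ (extChartAt (𝓡 n) p).source) :
    (fibreIntegral o U hm α).inChart p (extChartAt (𝓡 n) p q) =
      o.chartSign p q • prodFibreIntegral hm (EuclideanSpace.basisFun (Fin n) ℝ).toBasis volume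
        (α.inTangentChart p U) (extChartAt (𝓡 n) p q) := by
  let D : 𝔼 →L[ℝ] 𝔼 :=
    mfderiv 𝓘(ℝ, 𝔼) (𝓡 n) (extChartAt (𝓡 n) p).symm (extChartAt (𝓡 n) p q)
  have hD : D.IsInvertible :=
    isInvertible_mfderiv_extChartAt_symm (I := 𝓡 n) ((extChartAt (𝓡 n) p).map_source hq)
  let integrand : 𝔼 → 𝔼 [⋀^Fin k]→L[ℝ] ℝ := fun y => contractLast hm (E := 𝔼)
    (α (fibreIncl q y)) (sectionLift (fibreIncl q y))
    (fun i => verticalLift (fibreIncl q y) (EuclideanSpace.basisFun (Fin n) ℝ i))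
  have hdet := det_fibreCoord_ne_zero hq
  have hsign : LinearMap.det (fibreCoord n p q : 𝔼 →ₗ[ℝ] 𝔼) *
      |LinearMap.det (fibreCoord n p q : 𝔼 →ₗ[ℝ] 𝔼)|⁻¹ =
        SignType.sign (LinearMap.det (fibreCoord n p q : 𝔼 →ₗ[ℝ] 𝔼)) :=
    (mul_inv_eq_iff_eq_mul₀ (abs_ne_zero.2 hdet)).2 (sign_mul_abs _).symm
  have hinChart : (fibreIntegral o U hm α).inChart p (extChartAt (𝓡 n) p q) =
      o.sign q • (∫ y in {y : 𝔼 | fibreIncl q y ∈ U}, integrand y).compContinuousLinearMap D := by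
    rw [DiffForm.inChart, (extChartAt (𝓡 n) p).left_inv hq]
    rfl
  rw [hinChart, integral_compContinuousLinearMap hD,
    ← integral_indicator (isOpen_setOf_fibreIncl_mem hU q).measurableSet]
  simp_rw [integrand, D, indicator_contractLast_compContinuousLinearMap hm α hq]
  rw [integral_smul, integral_comp_eq_abs_det_inv_smul volume hdet fun y =>
    contractLast hm (α.inTangentChart p U (extChartAt (𝓡 n) p q, y)) _ _, smul_smul, smul_smul,
    mul_assoc, hsign]
  rfl

theorem ManifoldOrientation.exists_eventually_chartSign_eq (o : ManifoldOrientation n M) (p : M) :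
    ∃ ε : ℝ, ∀ᶠ q in 𝓝 p, o.chartSign p q = ε := by
  classical
  obtain ⟨w, hw⟩ := o.locally_constant p
  set b := (EuclideanSpace.basisFun (Fin n) ℝ).toBasis.orientation
  have hb : -b ≠ b := (Module.Ray.ne_neg_self b).symm
  have hcard : Fintype.card (Fin n) = Module.finrank ℝ 𝔼 := by simp
  refine ⟨if w = b then 1 else -1, ?_⟩
  filter_upwards [hw, extChartAt_source_mem_nhds (I := 𝓡 n) p] with q hq hqs
  have hqb : q ∈ (trivializationAt 𝔼 (TangentSpace (𝓡 n)) p).baseSet := by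
    rwa [extChartAt_source] at hqs
  let T : 𝔼 ≃ₗ[ℝ] 𝔼 := (trivializationAt 𝔼 (TangentSpace (𝓡 n)) p).linearEquivAt ℝ q hqb
  let a : Orientation ℝ 𝔼 (Fin n) := o.orient q
  have hTa : Orientation.map (Fin n) T a = w := hq hqb
  change (if a = b then 1 else -1) * (SignType.sign (LinearMap.det (T : 𝔼 →ₗ[ℝ] 𝔼)) : ℝ) = _
  have hdet : LinearMap.det (T : 𝔼 →ₗ[ℝ] 𝔼) ≠ 0 := det_fibreCoord_ne_zero hqs
  rcases hdet.lt_or_gt with hneg | hpos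
  · rw [(Orientation.map_eq_neg_iff_det_neg a T hcard).2 hneg] at hTa
    rw [← hTa, sign_neg hneg]
    obtain ha | ha : a = b ∨ a = -b :=
      (EuclideanSpace.basisFun (Fin n) ℝ).toBasis.orientation_eq_or_eq_neg a
    · rw [ha, if_pos rfl, if_neg hb, SignType.coe_neg_one, one_mul]
    · rw [ha, if_neg hb, if_pos (neg_neg b), SignType.coe_neg_one, neg_one_mul, neg_neg]
  · rw [(Orientation.map_eq_iff_det_pos a T hcard).2 hpos] at hTa
    rw [hTa, sign_pos hpos, SignType.coe_one, mul_one]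

theorem exists_fibreIntegral_inChart_eventuallyEq (o : ManifoldOrientation n M) (hU : IsOpen U)
    (hm : m = k + n) (α : DiffForm (𝓡 n).tangent (TangentBundle (𝓡 n) M) m) (p : M) :
    ∃ ε : ℝ, (fibreIntegral o U hm α).inChart p =ᶠ[𝓝 (extChartAt (𝓡 n) p p)]
      ε • prodFibreIntegral hm (EuclideanSpace.basisFun (Fin n) ℝ).toBasis volume
        (α.inTangentChart p U) := by
  obtain ⟨ε, hε⟩ := o.exists_eventually_chartSign_eq p
  refine ⟨ε, ?_⟩
  have hsymm : Tendsto (extChartAt (𝓡 n) p).symm (𝓝 (extChartAt (𝓡 n) p p)) (𝓝 p) := by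
    have hcont := continuousAt_extChartAt_symm (I := 𝓡 n) p
    rwa [ContinuousAt, extChartAt_to_inv] at hcont
  filter_upwards [hsymm.eventually hε, (isOpen_extChartAt_target (I := 𝓡 n) p).mem_nhds
    (mem_extChartAt_target p)] with x hx hx_target
  have hchart := fibreIntegral_inChart o hU hm α ((extChartAt (𝓡 n) p).map_target hx_target)
  rwa [hx, (extChartAt (𝓡 n) p).right_inv hx_target] at hchart

end FibreIntegralInChart

/-! ### Conservation of the current -/

theorem continuousAt_extDeriv {V : Type*} [NormedAddCommGroup V] [NormedSpace ℝ V] {k : ℕ}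
    {α : V → V [⋀^Fin k]→L[ℝ] ℝ} {x : V} (hα : ContDiffAt ℝ 1 α x) :
    ContinuousAt (extDeriv α) x :=
  (ContinuousAlternatingMap.alternatizeUncurryFinCLM ℝ V ℝ).continuous.continuousAt.comp
    (hα.fderiv_right (m := 0) le_rfl).continuousAt

section Conservation

variable {n : ℕ} {M : Type*} [TopologicalSpace M] [ChartedSpace (EuclideanSpace ℝ (Fin n)) M]
  [IsManifold (𝓡 n) ∞ M] {U : Set (TangentBundle (𝓡 n) M)} {p : M} {k m : ℕ}

local notation "𝔼" => EuclideanSpace ℝ (Fin n)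

section Support

variable {α : DiffForm (𝓡 n).tangent (TangentBundle (𝓡 n) M) m}

theorem HasProperVerticalSupport.hasProperSupportNear [T2Space M]
    (hα : HasProperVerticalSupport U α) (p : M) :
    HasProperSupportNear (chartPreimage p U) (α.inTangentChart p U) (extChartAt (𝓡 n) p p) := by
  obtain ⟨r, hr, hr_target⟩ := Metric.nhds_basis_closedBall.mem_iff.1
    ((isOpen_extChartAt_target (I := 𝓡 n) p).mem_nhds (mem_extChartAt_target p))
  set K := (extChartAt (𝓡 n) p).symm '' Metric.closedBall (extChartAt (𝓡 n) p p) r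
  have hK : IsCompact K :=
    (isCompact_closedBall _ _).image_of_continuousOn
      ((continuousOn_extChartAt_symm p).mono hr_target)
  obtain ⟨C, hCU, hC, hαC⟩ := hα K hK
  have hproj : Continuous (fun u : TangentBundle (𝓡 n) M => u.proj) :=
    FiberBundle.continuous_proj 𝔼 (TangentSpace (𝓡 n))
  have hsource : C ∩ TotalSpace.proj ⁻¹' K ⊆ (tangentChart n p).source := by
    rintro u ⟨-, x, hx, hxu⟩
    rw [mem_tangentChart_source, ← hxu]
    exact (extChartAt (𝓡 n) p).map_target (hr_target hx)
  refine ⟨tangentChart n p '' (C ∩ TotalSpace.proj ⁻¹' K), ?_, ?_, ?_⟩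
  · rintro _ ⟨u, hu, rfl⟩
    refine ⟨(tangentChart n p).map_source (hsource hu), ?_⟩
    rw [mem_preimage, (tangentChart n p).left_inv (hsource hu)]
    exact hCU hu.1
  · exact (hC.inter_right (hK.isClosed.preimage hproj)).image_of_continuousOn
      ((continuousOn_extChartAt _).mono hsource)
  · filter_upwards [Metric.closedBall_mem_nhds _ hr] with x hx y hy
    refine DiffForm.inTangentChart_eq_zero fun hyU => ?_
    have hxK : ((tangentChart n p).symm (x, y)).proj ∈ K := mem_image_of_mem _ hx
    exact hαC _ hyU hxK fun hyC => hy ⟨_, ⟨hyC, hxK⟩,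
      (tangentChart n p).right_inv (mem_tangentChart_target.2 (hr_target hx))⟩

theorem HasVerticalCompactSupport.exists_isCompact_inTangentChart
    (hα : HasVerticalCompactSupport U α) (p : M) (x : 𝔼) :
    ∃ K : Set 𝔼, IsCompact K ∧ (∀ y ∈ K, (x, y) ∈ chartPreimage p U) ∧
      ∀ y ∉ K, α.inTangentChart p U (x, y) = 0 := by
  by_cases hx : x ∈ (extChartAt (𝓡 n) p).target
  · obtain ⟨K, hK, hKU, hαK⟩ := hα ((extChartAt (𝓡 n) p).symm x)
    refine ⟨fibreCoord n p ((extChartAt (𝓡 n) p).symm x) '' K,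
      hK.image (ContinuousLinearMap.continuous _), ?_, fun y hy => ?_⟩
    · rintro _ ⟨y, hy, rfl⟩
      have hmem := (mem_chartPreimage_iff ((extChartAt (𝓡 n) p).map_target hx) y).2 (hKU y hy)
      rwa [(extChartAt (𝓡 n) p).right_inv hx] at hmem
    · exact DiffForm.inTangentChart_eq_zero fun hyU => hαK _ hyU fun hyK =>
        hy ⟨_, hyK, fibreCoord_tangentChart_symm_snd (z := (x, y)) hx⟩
  · exact ⟨∅, isCompact_empty, by simp, fun y _ => α.inTangentChart_of_notMem fun hy =>
      hx (fst_mem_target_of_mem_chartPreimage hy)⟩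

theorem HasVerticalCompactSupport.dense_setOf_hasProperSupportNear
    (hα : HasVerticalCompactSupport U α) (hU : IsOpen U) (hαU : α.SmoothOn U) (p : M) :
    Dense {x : 𝔼 | HasProperSupportNear (chartPreimage p U) (α.inTangentChart p U) x} :=
  _root_.dense_setOf_hasProperSupportNear (isOpen_chartPreimage hU)
    (fun _ hz => (hαU.contDiffAt_inTangentChart hU hz).continuousAt.continuousWithinAt)
    (fun _ hz => α.inTangentChart_of_notMem hz) (hα.exists_isCompact_inTangentChart p)

end Support

theorem HasProperVerticalSupport.smoothOn_fibreIntegral [T2Space M] (o : ManifoldOrientation n M)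
    (hU : IsOpen U) (hm : m = k + n) {α : DiffForm (𝓡 n).tangent (TangentBundle (𝓡 n) M) m}
    (hα : HasProperVerticalSupport U α) (hαU : α.SmoothOn U) :
    (fibreIntegral o U hm α).SmoothOn univ := fun p _ => by
  obtain ⟨ε, hε⟩ := exists_fibreIntegral_inChart_eventuallyEq o hU hm α p
  have htube : ContDiffInTubeAt ∞ (α.inTangentChart p U) (extChartAt (𝓡 n) p p) :=
    (hα.hasProperSupportNear p).contDiffInTubeAt fun _ hz => hαU.contDiffAt_inTangentChart hU hz
  have hsmooth := contDiffAt_prodFibreIntegral (μ := volume) (r := ⊤) hm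
    (EuclideanSpace.basisFun (Fin n) ℝ).toBasis htube
  exact (contDiffAt_const.smul hsmooth).congr_of_eventuallyEq hε

variable {χ : DiffForm (𝓡 n).tangent (TangentBundle (𝓡 n) M) 1}
  {θ : DiffForm (𝓡 n).tangent (TangentBundle (𝓡 n) M) k}

theorem extDeriv_prodFibreIntegral_inTangentChart_eq_zero (hm : k + 1 = m + n) (hn : n = m + 1)
    (hU : IsOpen U)
    (hUc : ∀ u ∈ U, ∀ c : ℝ, 0 < c → (⟨u.proj, c • u.2⟩ : TangentBundle (𝓡 n) M) ∈ U)
    (hθ : θ.SmoothOn U) (hθd : ∀ u ∈ U, θ.d u = 0) (hθr : θ.ContractionVanishesOn radialField U)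
    (hχ : χ.SmoothOn U) (hχray : ∀ u ∈ U, ∫ c in Ioi (0 : ℝ), rayCoefficient χ u c = 1) {x : 𝔼}
    (hx : HasProperSupportNear (chartPreimage p U) ((χ.wedgeOne θ).inTangentChart p U) x) :
    extDeriv (prodFibreIntegral hm (EuclideanSpace.basisFun (Fin n) ℝ).toBasis volume
      ((χ.wedgeOne θ).inTangentChart p U)) x = 0 := by
  have : Nonempty (Fin n) := ⟨⟨0, by omega⟩⟩
  refine extDeriv_prodFibreIntegral_eq_zero
    (χ := χ.inChart (⟨p, (0 : 𝔼)⟩ : TangentBundle (𝓡 n) M)) hm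
    (by rw [finrank_euclideanSpace_fin, hn]) (EuclideanSpace.basisFun (Fin n) ℝ).toBasis
    (isClosedRadiallyHorizontalOn_chartPreimage hU hUc hθ hθd hθr p)
    (fun z hz => ?_) (fun z hz => ?_) (hx.contDiffInTubeAt fun z hz => ?_)
    fun y hy => hx.eventuallyEq_zero hy
  · rw [integral_inChart_radialScaling χ (fst_mem_target_of_mem_chartPreimage hz), hχray _ hz.2]
  · exact ((χ.wedgeOne θ).inTangentChart_of_mem hz).trans (χ.wedgeOne_inChart θ _ z)
  · exact ((hχ.wedgeOne hθ).contDiffAt_inTangentChart hU hz).of_le (by simp)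

theorem d_fibreIntegral_wedgeOne_eq_zero (hm : k + 1 = m + n) (hn : n = m + 1)
    (o : ManifoldOrientation n M) (hU : IsOpen U)
    (hUc : ∀ u ∈ U, ∀ c : ℝ, 0 < c → (⟨u.proj, c • u.2⟩ : TangentBundle (𝓡 n) M) ∈ U)
    (hθ : θ.SmoothOn U) (hθd : ∀ u ∈ U, θ.d u = 0) (hθr : θ.ContractionVanishesOn radialField U)
    (hχ : χ.SmoothOn U) (hχray : ∀ u ∈ U, ∫ c in Ioi (0 : ℝ), rayCoefficient χ u c = 1)
    (hc : HasVerticalCompactSupport U (χ.wedgeOne θ))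
    (hJ : (fibreIntegral o U hm (χ.wedgeOne θ)).SmoothOn univ) (p : M) :
    (fibreIntegral o U hm (χ.wedgeOne θ)).d p = 0 := by
  set J := (fibreIntegral o U hm (χ.wedgeOne θ)).inChart p
  obtain ⟨ε, hε⟩ := exists_fibreIntegral_inChart_eventuallyEq o hU hm (χ.wedgeOne θ) p
  have hcont : ContinuousAt (extDeriv J) (extChartAt (𝓡 n) p p) :=
    continuousAt_extDeriv ((hJ p (mem_univ p)).of_le (by simp))
  have hdense := hc.dense_setOf_hasProperSupportNear hU (hχ.wedgeOne hθ) p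
  refine DiffForm.d_eq_zero ?_
  by_contra hne
  obtain ⟨x, hx, hJx, hεx⟩ := mem_closure_iff_frequently.1 (hdense (extChartAt (𝓡 n) p p))
    |>.and_eventually ((hcont.eventually_ne hne).and hε.eventually_nhds) |>.exists
  apply hJx
  rw [EventuallyEq.extDeriv_eq hεx, extDeriv_smul,
    extDeriv_prodFibreIntegral_inTangentChart_eq_zero hm hn hU hUc hθ hθd hθr hχ hχray hx,
    smul_zero]

end Conservation

end

theorem mainTheorem9_general {n : ℕ} (hn : 1 ≤ n)
    {M : Type*} [TopologicalSpace M] [T2Space M]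
    [ChartedSpace (EuclideanSpace ℝ (Fin n)) M] [IsManifold (𝓡 n) ∞ M]
    (o : ManifoldOrientation n M) {U : Set (TangentBundle (𝓡 n) M)} (hU : IsOpen U)
    (hUc : ∀ u ∈ U, ∀ c : ℝ, 0 < c → (⟨u.proj, c • u.2⟩ : TangentBundle (𝓡 n) M) ∈ U)
    {θ : DiffForm (𝓡 n).tangent (TangentBundle (𝓡 n) M) (2 * n - 2)} (hθ : θ.SmoothOn U)
    (hθd : ∀ u ∈ U, θ.d u = 0) (hθr : θ.ContractionVanishesOn radialField U)
    {χ : DiffForm (𝓡 n).tangent (TangentBundle (𝓡 n) M) 1} (hχ : χ.SmoothOn U)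
    (hχray : ∀ u ∈ U, ∫ c in Ioi (0 : ℝ), rayCoefficient χ u c = 1)
    (hc : HasVerticalCompactSupport U (χ.wedgeOne θ)) :
    (HasProperVerticalSupport U (χ.wedgeOne θ) → (current hn o U χ θ).SmoothOn univ) ∧
    ((current hn o U χ θ).SmoothOn univ → ∀ p : M, (current hn o U χ θ).d p = 0) :=
  ⟨fun hproper => hproper.smoothOn_fibreIntegral o hU (by omega) (hχ.wedgeOne hθ),
    d_fibreIntegral_wedgeOne_eq_zero (by omega) (by omega) o hU hUc hθ hθd hθr hχ hχray hc⟩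

theorem mainTheorem9 {n : ℕ} (hn : 1 ≤ n)
    {M : Type*} [TopologicalSpace M] [T2Space M] [SecondCountableTopology M] [ConnectedSpace M]
    [ChartedSpace (EuclideanSpace ℝ (Fin n)) M] [IsManifold (𝓡 n) ∞ M]
    (o : ManifoldOrientation n M)
    (U : Set (TangentBundle (𝓡 n) M)) (hU : IsConicSubbundle U)
    (Ψ : BivectorField (𝓡 n).tangent (TangentBundle (𝓡 n) M)) (hΨ : IsVlasovBivector U Ψ)
    (θ : DiffForm (𝓡 n).tangent (TangentBundle (𝓡 n) M) (2 * n - 2))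
    (hθ : TransportEquations U Ψ θ)
    (χ : DiffForm (𝓡 n).tangent (TangentBundle (𝓡 n) M) 1) (hχ : IsSupportForm U χ)
    (hc : HasVerticalCompactSupport U (χ.wedgeOne θ)) :
    (HasProperVerticalSupport U (χ.wedgeOne θ) → (current hn o U χ θ).SmoothOn univ) ∧
    ((current hn o U χ θ).SmoothOn univ → ∀ p : M, (current hn o U χ θ).d p = 0) := by
  obtain ⟨W, hW, hΨW⟩ := hΨ
  exact mainTheorem9_general hn o hU.isOpen
    (fun u hu c hc => hU.smul_mem u hu c hc.ne') hθ.smooth hθ.closed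
    (hθ.null _ W (smoothVectorFieldOn_radialField U) hW.smooth hΨW).1
    hχ.smooth hχ.integral_eq_one hc
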